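/- A finite state machine (FSM) $\mathbf S=(S,I,O,h)$ consists of a finite set $S$ of states, finite non-empty disjoint sets $I$, $O$ of inputs and outputs, and a transition relation $h\subseteq S\times I\times O\times S$. An input $i$ is defined at $s$ if $(s,i,o,s')\in h$ for some $o,s'$; a state with no defined input is a deadlock state. $\mathbf S$ is complete if every input is defined at every state, observable if $(s,i,o,s_1),(s,i,o,s_2)\in h$ implies $s_1=s_2$, single-input if at most one input is defined at each state, and output-complete if, whenever $i$ is defined at $s$, there is for each $o\in O$ a transition $(s,i,o,s')\in h$. For a sequence $\gamma$ of input/output pairs, the $\gamma$-successor of $s$ is the set of the states reached from $s$ along paths labelled by $\gamma$ (empty if there are none). A test case over $I,O$ is a single-input, output-complete, observable FSM $\mathbf P$ with inputs $I$, outputs $O$ and an initial state from which all its states are reachable, whose transition diagram has no cycles. A test case $\mathbf P$ is a homing test case for $\mathbf S$ if for each trace $\gamma$ of $\mathbf P$ from its initial state to a deadlock state there is a state $s$ of $\mathbf S$ such that for every state $s'$ of $\mathbf S$ the $\gamma$-successor of $s'$ is empty or equal to $\{s\}$. **Proposition 5.** The problem of checking the existence of a homing test case for a complete observable (possibly nondeterministic)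 FSM is in P. Precisely: encode an FSM with states, inputs and outputs numbered $1,\dots,n$; $1,\dots,m$; $1,\dots,k$ as the binary word $1^n0\,1^m0\,1^k0\,T$, where $T$ lists the $n\cdot m\cdot k\cdot n$ bits of the characteristic table of $h$ in lexicographic order of $(s,i,o,s')$. Then the language of the codes of all complete observable FSMs that have a homing test case is decided by a (multi-stack) Turing machine in time polynomial in the length of the input word. Moreover, for every polynomial $q$ there is a polynomial $r$ such that the same machine, on the code of a complete observable FSM with $n$ states and at most $q(n)$ inputs and at most $q(n)$ outputs, answers correctly whether a homing test case exists after at most $r(n)$ steps. -/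

import Mathlib

/-- A finite state machine with states `S`, inputs `I` and outputs `O`, given by its transition
relation; finiteness of `S`, `I`, `O` and non-emptiness of `I`, `O` are required where machines
are quantified over.  Inputs and outputs are distinct types, hence disjoint. -/
structure FSM (S I O : Type*) where
  /-- `trans s i o s'` says that `(s, i, o, s')` is a transition. -/
  trans : S → I → O → S → Prop

namespace FSM

variable {S I O : Type*}

/-- The input `i` is defined at the state `s`. -/
def DefinedAt (M : FSM S I O) (s : S) (i : I) : Prop :=
  ∃ o s', M.trans s i o s'

/-- Every input is defined at every state. -/
def Complete (M : FSM S I O) : Prop :=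
  ∀ s i, M.DefinedAt s i

/-- State, input and output determine the next state. -/
def Observable (M : FSM S I O) : Prop :=
  ∀ s i o s₁ s₂, M.trans s i o s₁ → M.trans s i o s₂ → s₁ = s₂

/-- At each state at most one input is defined. -/
def SingleInput (M : FSM S I O) : Prop :=
  ∀ s i₁ i₂, M.DefinedAt s i₁ → M.DefinedAt s i₂ → i₁ = i₂

/-- Each input defined at a state admits there a transition for every output. -/
def OutputComplete (M : FSM S I O) : Prop :=
  ∀ s i, M.DefinedAt s i → ∀ o, ∃ s', M.trans s i o s'

/-- `M.Reaches s γ t`: the sequence `γ` of input/output pairs labels a path from `s` to `t`. -/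
def Reaches (M : FSM S I O) : S → List (I × O) → S → Prop
  | s, [], t => s = t
  | s, io :: γ, t => ∃ u, M.trans s io.1 io.2 u ∧ M.Reaches u γ t

/-- The `γ`-successor of a state (the empty set if `γ` is not a trace at `s`). -/
def successor (M : FSM S I O) (s : S) (γ : List (I × O)) : Set S :=
  {t | M.Reaches s γ t}

/-- A deadlock state: no input is defined there. -/
def Deadlock (M : FSM S I O) (s : S) : Prop :=
  ∀ i, ¬ M.DefinedAt s i

/-- The edge relation of the transition diagram. -/
def Edge (M : FSM S I O) (s t : S) : Prop :=
  ∃ i o, M.trans s i o t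

/-- The transition diagram has no cycles. -/
def Acyclic (M : FSM S I O) : Prop :=
  ∀ s, ¬ Relation.TransGen M.Edge s s

/-- Every state is reachable from `s₀`. -/
def InitiallyConnected (M : FSM S I O) (s₀ : S) : Prop :=
  ∀ s, Relation.ReflTransGen M.Edge s₀ s

/-- The machine `P` initialized at `p₀` is a test case. -/
structure IsTestCase {Q : Type*} (P : FSM Q I O) (p₀ : Q) : Prop where
  finite : Finite Q
  initiallyConnected : P.InitiallyConnected p₀
  singleInput : P.SingleInput
  outputComplete : P.OutputComplete
  observable : P.Observable
  acyclic : P.Acyclic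

/-- The machine `P` initialized at `p₀` is homing for the set `A` of states of `M`. -/
def IsHomingFor {Q : Type*} (P : FSM Q I O) (p₀ : Q) (M : FSM S I O) (A : Set S) : Prop :=
  ∀ γ d, P.Reaches p₀ γ d → P.Deadlock d →
    ∃ s, ∀ s' ∈ A, M.successor s' γ = ∅ ∨ M.successor s' γ = {s}

/-- The set `A` of states is adaptively homing: some test case is homing for it. -/
def HomingSet (M : FSM S I O) (A : Set S) : Prop :=
  ∃ (Q : Type) (P : FSM Q I O) (p₀ : Q), P.IsTestCase p₀ ∧ P.IsHomingFor p₀ M A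

/-- The machine is adaptively homing: some test case is homing for the set of all its states. -/
def AdaptivelyHoming (M : FSM S I O) : Prop :=
  M.HomingSet Set.univ

open Classical in
/-- The binary code of a machine with `n` states, `m` inputs and `k` outputs: the numbers
`n`, `m`, `k` in unary, each closed by a `0`, followed by the `n * m * k * n` bits of the
characteristic table of the transition relation. -/
noncomputable def code {n m k : ℕ} (M : FSM (Fin n) (Fin m) (Fin k)) : List Bool :=
  List.replicate n true ++ [false] ++
  (List.replicate m true ++ [false]) ++
  (List.replicate k true ++ [false]) ++
  (List.finRange n).flatMap fun s =>
    (List.finRange m).flatMap fun i =>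
      (List.finRange k).flatMap fun o =>
        (List.finRange n).map fun s' => decide (M.trans s i o s')

/-- The adaptive homing problem as a language: the codes of the complete observable machines
that have a homing test case. -/
def adaptiveHomingLanguage : Set (List Bool) :=
  {w | ∃ (n m k : ℕ) (M : FSM (Fin n) (Fin m) (Fin k)), 0 < m ∧ 0 < k ∧
    M.Complete ∧ M.Observable ∧ M.AdaptivelyHoming ∧ M.code = w}

end FSM

open Classical in
/-- Polynomial-time deciders of a language: Turing machines that, on every binary word `w`, halt
after at most polynomially many steps in the length of `w`, with the one-bit output telling
whether `w` belongs to `L`.  The language `L` is in the class P if and only if there is one. -/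
abbrev PolyTimeDecider (L : Set (List Bool)) : Type 1 :=
  Turing.TM2ComputableInPolyTime (id : List Bool → List Bool) Computability.encodeBool
    (fun w => decide (w ∈ L))

open Classical in
/-- The machine `A`, started on the binary word `w`, halts after at most `t` steps with the
one-bit output telling whether the proposition `p` holds. -/
def AnswersInTime (A : Turing.TM2ComputableAux Bool Bool) (w : List Bool) (p : Prop) (t : ℕ) :
    Prop :=
  Nonempty (Turing.TM2OutputsInTime A.tm (w.map A.inputAlphabet.invFun)
    (some ((Computability.encodeBool (decide p)).map A.outputAlphabet.invFun)) t)

/-!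
Two states are pairwise homing if an experiment merges them or tells them apart. In an observable
machine no input enlarges the set of possible states, so if all pairs of states are pairwise homing
they can be treated one after another until at most one possible state is left; hence a homing test
case exists if and only if every pair is pairwise homing. The set of these pairs is the least fixed
point of a monotone operator on sets of pairs, reached from the empty set after `n ^ 2` steps.

The operator is definable by a formula of bounded arithmetic about the code of the machine and the
current set, stored as a table of bits. For fixed formulas a stack machine working in unary
evaluates them, and hence also iterates the operator, in polynomial time. The bound in the number of
states follows since the code has polynomial length in `n` if `m, k ≤ q(n)`.
-/

/-! ### Programs on stacks of bits -/

/-- Structured programs on stacks of bits indexed by `K`. Conditions test the top of a stack. -/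
inductive StackProg (K : Type) : Type
  | skip
  | push (k : K) (b : Bool)
  | pop (k : K)
  | seq (p q : StackProg K)
  | ite (k : K) (c : Option Bool → Bool) (p q : StackProg K)
  | loop (k : K) (c : Option Bool → Bool) (p : StackProg K)

namespace StackProg

open Function Turing

variable {K : Type}

/-- The labels of the machine running a program. -/
def Label : StackProg K → Type
  | skip | push _ _ | pop _ => Unit
  | seq p q => p.Label ⊕ q.Label
  | ite _ _ p q => Option (p.Label ⊕ q.Label)
  | loop _ _ p => Option p.Label

@[reducible]
def labelFintype : (p : StackProg K) → Fintype p.Label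
  | skip | push _ _ | pop _ => inferInstanceAs (Fintype Unit)
  | seq p q =>
    letI := p.labelFintype
    letI := q.labelFintype
    inferInstanceAs (Fintype (p.Label ⊕ q.Label))
  | ite _ _ p q =>
    letI := p.labelFintype
    letI := q.labelFintype
    inferInstanceAs (Fintype (Option (p.Label ⊕ q.Label)))
  | loop _ _ p =>
    letI := p.labelFintype
    inferInstanceAs (Fintype (Option p.Label))

/-- The label at which a program starts. -/
def entry : (p : StackProg K) → p.Label
  | skip | push _ _ | pop _ => ()
  | seq p _ => Sum.inl p.entry
  | ite _ _ _ _ | loop _ _ _ => none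

/-- The machine code of a program whose labels are embedded by `e` into the labels of a larger
machine and which continues at the label `next`. The internal state of the machine only holds the
bit under test. -/
def stmt {Λ : Type} : (p : StackProg K) → (p.Label → Λ) → Λ → p.Label →
    TM2.Stmt (fun _ : K => Bool) Λ (Option Bool)
  | skip, _, next, _ => .goto fun _ => next
  | push k b, _, next, _ => .push k (fun _ => b) (.goto fun _ => next)
  | pop k, _, next, _ => .pop k (fun v _ => v) (.goto fun _ => next)
  | seq p q, e, _, Sum.inl l => p.stmt (fun l => e (Sum.inl l)) (e (Sum.inr q.entry)) l
  | seq _ q, e, next, Sum.inr l => q.stmt (fun l => e (Sum.inr l)) next l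
  | ite k c p q, e, _, none =>
    .peek k (fun _ b => b) (.branch c (.goto fun _ => e (some (Sum.inl p.entry)))
      (.goto fun _ => e (some (Sum.inr q.entry))))
  | ite _ _ p _, e, next, some (Sum.inl l) => p.stmt (fun l => e (some (Sum.inl l))) next l
  | ite _ _ _ q, e, next, some (Sum.inr l) => q.stmt (fun l => e (some (Sum.inr l))) next l
  | loop k c p, e, next, none =>
    .peek k (fun _ b => b) (.branch c (.goto fun _ => e (some p.entry)) (.goto fun _ => next))
  | loop _ _ p, e, _, some l => p.stmt (fun l => e (some l)) (e none) l

variable [DecidableEq K]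

/-- `Runs p S T S'`: started on the stacks `S`, the program `p` ends with the stacks `S'` after
at most `T` steps. -/
inductive Runs : StackProg K → (K → List Bool) → ℕ → (K → List Bool) → Prop
  | skip {S} : Runs skip S 1 S
  | push {k b S} : Runs (push k b) S 1 (update S k (b :: S k))
  | pop {k S} : Runs (pop k) S 1 (update S k (S k).tail)
  | seq {p q S S' S'' T U} : Runs p S T S' → Runs q S' U S'' → Runs (seq p q) S (T + U) S''
  | ite_true {k c p q S T S'} : c (S k).head? = true → Runs p S T S' →
      Runs (ite k c p q) S (T + 1) S'
  | ite_false {k c p q S T S'} : c (S k).head? = false → Runs q S T S' →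
      Runs (ite k c p q) S (T + 1) S'
  | loop_true {k c p S S' S'' T U} : c (S k).head? = true → Runs p S T S' →
      Runs (loop k c p) S' U S'' → Runs (loop k c p) S (U + (T + 1)) S''
  | loop_false {k c p S} : c (S k).head? = false → Runs (loop k c p) S 1 S
  | mono {p S S' T U} : Runs p S T S' → T ≤ U → Runs p S U S'

namespace Runs

variable {p : StackProg K} {S S' S'' : K → List Bool} {T U : ℕ}

theorem of_eq (h : Runs p S T S') (hS : S' = S'') (hT : T ≤ U) : Runs p S U S'' :=
  hS ▸ h.mono hT

theorem exists_iterate_step (h : Runs p S T S') {Λ : Type}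
    (m : Λ → TM2.Stmt (fun _ : K => Bool) Λ (Option Bool)) (e : p.Label → Λ) (next : Λ)
    (hm : ∀ l, m (e l) = p.stmt e next l) (v : Option Bool) :
    ∃ t ≤ T, ∃ v', (flip bind (TM2.step m))^[t] (some ⟨some (e p.entry), v, S⟩) =
      some ⟨some next, v', S'⟩ := by
  induction h generalizing next v with
  | skip | push | pop =>
    exact ⟨1, le_rfl, v, by simp [flip, TM2.step, hm, stmt, TM2.stepAux]⟩
  | @seq p q _ _ _ T U _ _ ihp ihq =>
    obtain ⟨t, ht, v₁, h₁⟩ := ihp (fun l => e (Sum.inl l)) (e (Sum.inr q.entry))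
      (fun l => hm (Sum.inl l)) v
    obtain ⟨u, hu, v₂, h₂⟩ := ihq (fun l => e (Sum.inr l)) next (fun l => hm (Sum.inr l)) v₁
    refine ⟨u + t, by omega, v₂, ?_⟩
    rw [iterate_add_apply]
    exact (congrArg _ h₁).trans h₂
  | @ite_true k c p q S T S' hc _ ih =>
    obtain ⟨t, ht, v', h⟩ := ih (fun l => e (some (Sum.inl l))) next
      (fun l => hm (some (Sum.inl l))) (S k).head?
    refine ⟨t + 1, by omega, v', ?_⟩
    rw [iterate_add_apply, ← h]
    simp [flip, TM2.step, entry, hm none, stmt, TM2.stepAux, hc]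
  | @ite_false k c p q S T S' hc _ ih =>
    obtain ⟨t, ht, v', h⟩ := ih (fun l => e (some (Sum.inr l))) next
      (fun l => hm (some (Sum.inr l))) (S k).head?
    refine ⟨t + 1, by omega, v', ?_⟩
    rw [iterate_add_apply, ← h]
    simp [flip, TM2.step, entry, hm none, stmt, TM2.stepAux, hc]
  | @loop_true k c p S S' S'' T U hc _ _ ih ih' =>
    obtain ⟨t, ht, v₁, h₁⟩ := ih (fun l => e (some l)) (e none) (fun l => hm (some l)) (S k).head?
    obtain ⟨u, hu, v₂, h₂⟩ := ih' e next hm v₁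
    refine ⟨u + (t + 1), by omega, v₂, ?_⟩
    rw [iterate_add_apply, iterate_add_apply, ← h₂]
    refine congrArg _ (Eq.trans (congrArg _ ?_) h₁)
    simp [flip, TM2.step, entry, hm none, stmt, TM2.stepAux, hc]
  | @loop_false k c p S hc =>
    exact ⟨1, le_rfl, (S k).head?,
      by simp [flip, TM2.step, entry, hm none, stmt, TM2.stepAux, hc]⟩
  | mono _ hTU ih =>
    obtain ⟨t, ht, h⟩ := ih e next hm v
    exact ⟨t, ht.trans hTU, h⟩

end Runs

/-- The machine that runs a program and halts; its internal state is reset at the end because the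
final configuration of `TM2OutputsInTime` has to carry the initial one. -/
def machine [Fintype K] (p : StackProg K) (k₀ k₁ : K) : FinTM2 :=
  letI := p.labelFintype
  { K := K
    k₀ := k₀
    k₁ := k₁
    Γ := fun _ => Bool
    Λ := Option p.Label
    main := some p.entry
    ΛFin := inferInstanceAs (Fintype (Option p.Label))
    σ := Option Bool
    initialState := none
    Γk₀Fin := inferInstanceAs (Fintype Bool)
    m := fun l => match l with
      | none => .load (fun _ => none) .halt
      | some l => p.stmt some none l }

theorem Runs.outputsInTime [Fintype K] {p : StackProg K} {k₀ k₁ : K} {w w' : List Bool} {T : ℕ}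
    (h : Runs p (update (fun _ => []) k₀ w) T (update (fun _ => []) k₁ w')) :
    Nonempty (TM2OutputsInTime (p.machine k₀ k₁) w (some w') (T + 1)) := by
  obtain ⟨t, ht, v, key⟩ :=
    h.exists_iterate_step (p.machine k₀ k₁).m some none (fun _ => rfl) none
  have hstk (k' : K) (u : List Bool) (k : K) (h : k = k' → List Bool = List Bool) :
      (if hk : k = k' then (h hk).mpr u else []) = update (fun _ => []) k' u k := by
    by_cases hk : k = k'
    · rw [dif_pos hk, hk, update_self]
      rfl
    · rw [dif_neg hk, update_of_ne hk]
  have hinit : initList (p.machine k₀ k₁) w =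
      ⟨some (some p.entry), none, update (fun _ => []) k₀ w⟩ :=
    congrArg _ (funext fun k => hstk k₀ w k fun _ => rfl)
  have hhalt : haltList (p.machine k₀ k₁) w' = ⟨none, none, update (fun _ => []) k₁ w'⟩ :=
    congrArg _ (funext fun k => hstk k₁ w' k fun _ => rfl)
  refine ⟨{ steps := t + 1, evals_in_steps := ?_, steps_le_m := Nat.succ_le_succ ht }⟩
  rw [hinit, add_comm, iterate_add_apply]
  exact (congrArg _ key).trans (congrArg some hhalt).symm

end StackProg

theorem replicate_sub_append {j v : ℕ} (hj : j < v) (l : List Bool) :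
    List.replicate (v - j) true ++ l = true :: (List.replicate (v - (j + 1)) true ++ l) := by
  rw [show v - j = v - (j + 1) + 1 by omega, List.replicate_succ, List.cons_append]

theorem cons_replicate_append (v : ℕ) (l : List Bool) :
    true :: (List.replicate v true ++ l) = List.replicate (v + 1) true ++ l :=
  rfl

theorem reverse_take_succ (l : List Bool) (j : ℕ) :
    (l.take (j + 1)).reverse = (l.drop j).head?.toList ++ (l.take j).reverse := by
  rw [List.take_add_one, List.reverse_append, List.head?_drop]
  cases l[j]? <;> rfl

namespace StackProg

open Function

variable {K : Type} [DecidableEq K] {a b k : K} {c : Option Bool → Bool} {p : StackProg K}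

theorem runs_push {b : Bool} {S S' : K → List Bool} (hS : update S k (b :: S k) = S') :
    Runs (push k b) S 1 S' :=
  hS ▸ .push

theorem runs_pop {S S' : K → List Bool} (hS : update S k (S k).tail = S') :
    Runs (pop k) S 1 S' :=
  hS ▸ .pop

theorem Runs.change {S S' R R' : K → List Bool} {T U : ℕ} (h : Runs p S T S') (hS : S = R)
    (hS' : S' = R') (hT : T ≤ U) : Runs p R U R' :=
  hS ▸ h.of_eq hS' hT

theorem runs_loop {C v : ℕ} {G : ℕ → K → List Bool} (hc : ∀ j < v, c (G j k).head? = true)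
    (hv : c (G v k).head? = false) (hp : ∀ j < v, Runs p (G j) C (G (j + 1))) :
    Runs (loop k c p) (G 0) (v * (C + 1) + 1) (G v) := by
  induction v generalizing G with
  | zero => simpa using Runs.loop_false hv
  | succ v ih =>
    have hrest := ih (G := fun j => G (j + 1)) (fun j hj => hc _ (by omega)) hv
      fun j hj => hp _ (by omega)
    exact (Runs.loop_true (hc 0 v.succ_pos) (hp 0 v.succ_pos) hrest).mono (by lia)

/-- Moves the top bit of the stack `a`, if any, to the stack `b`. -/
def move (a b : K) : StackProg K :=
  ite a (· == some true) (seq (pop a) (push b true))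
    (ite a (· == some false) (seq (pop a) (push b false)) skip)

theorem runs_move (hab : a ≠ b) (S : K → List Bool) :
    Runs (move a b) S 4 (update (update S a (S a).tail) b ((S a).head?.toList ++ S b)) := by
  have hmove (x : Bool) : Runs (seq (pop a) (push b x)) S 2
      (update (update S a (S a).tail) b (x :: S b)) :=
    (Runs.seq .pop .push).of_eq (by rw [update_of_ne hab.symm]) le_rfl
  rcases h : S a with _ | ⟨_ | _, l⟩
  · have hS : update S a [] = S := update_eq_self_iff.2 h.symm
    exact Runs.of_eq (T := 3) (.ite_false (by simp [h]) (.ite_false (by simp [h]) .skip))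
      (by simp [hS]) (by omega)
  · exact Runs.of_eq (.ite_false (by simp [h]) (.ite_true (by simp [h]) (hmove false)))
      (by simp [h]) (by omega)
  · exact Runs.of_eq (.ite_true (by simp [h]) (hmove true)) (by simp [h]) (by omega)

/-- Moves bits from the stack `a` to the stack `b` as long as the top of `a` satisfies `c`. -/
def moveWhile (c : Option Bool → Bool) (a b : K) : StackProg K :=
  loop a c (move a b)

theorem runs_moveWhile (hab : a ≠ b) {S : K → List Bool} {u l : List Bool} (hS : S a = u ++ l)
    (hu : ∀ x ∈ u, c (some x) = true) (hl : c l.head? = false) :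
    Runs (moveWhile c a b) S (5 * u.length + 1) (update (update S a l) b (u.reverse ++ S b)) := by
  have key := runs_loop (p := move a b) (k := a) (c := c) (C := 4) (v := u.length)
    (G := fun j => update (update S a (u.drop j ++ l)) b ((u.take j).reverse ++ S b))
  simp only [update_of_ne hab, update_self, List.drop_length, List.take_length, List.nil_append,
    List.drop_zero, List.take_zero, List.reverse_nil, ← hS, update_eq_self] at key
  refine (key (fun j hj => ?_) hl fun j hj => ?_).mono (by omega)
  · rw [List.drop_eq_getElem_cons hj]
    exact hu _ (u.getElem_mem hj)
  · refine (runs_move hab _).of_eq ?_ le_rfl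
    rw [List.drop_eq_getElem_cons hj, ← List.take_concat_get' u j hj]
    simp only [update_of_ne hab, update_self, update_idem, update_comm hab.symm, List.cons_append,
      List.tail_cons, List.head?_cons, Option.toList_some, List.reverse_append,
      List.reverse_singleton, List.nil_append]

/-- Moves the whole stack `a`, reversed, onto the stack `b`. -/
def pour (a b : K) : StackProg K :=
  moveWhile Option.isSome a b

theorem runs_pour (hab : a ≠ b) (S : K → List Bool) :
    Runs (pour a b) S (5 * (S a).length + 1) (update (update S a []) b ((S a).reverse ++ S b)) :=
  runs_moveWhile hab (List.append_nil _).symm (fun _ _ => rfl) rfl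

/-- Moves the leading ones of the stack `a` onto the stack `b`. -/
def pourOnes (a b : K) : StackProg K :=
  moveWhile (· == some true) a b

theorem runs_pourOnes (hab : a ≠ b) {S : K → List Bool} {v : ℕ} {l : List Bool}
    (hS : S a = List.replicate v true ++ l) (hl : l.head? ≠ some true) :
    Runs (pourOnes a b) S (5 * v + 1)
      (update (update S a l) b (List.replicate v true ++ S b)) := by
  have key := runs_moveWhile hab hS (c := (· == some true)) (by simp) (by simpa using hl)
  rwa [List.length_replicate, List.reverse_replicate] at key

/-- Empties the stack `a`. -/
def clear (a : K) : StackProg K :=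
  loop a Option.isSome (pop a)

theorem runs_clear (a : K) (S : K → List Bool) :
    Runs (clear a) S (2 * (S a).length + 1) (update S a []) := by
  have key := runs_loop (p := pop a) (k := a) (c := Option.isSome) (C := 1)
    (v := (S a).length) (G := fun j => update S a ((S a).drop j))
  simp only [update_self, List.drop_length, List.drop_zero, update_eq_self] at key
  refine (key (fun j hj => ?_) rfl fun j _ => ?_).mono (by omega)
  · rw [List.drop_eq_getElem_cons hj]
    rfl
  · exact Runs.pop.of_eq (by simp) le_rfl

/-- Takes a block of ones, closed by a zero, from the stack `a` and runs `p` that many times. The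
counter is kept on the stack `b`, shielded from `p` by a zero. -/
def countLoop (a b : K) (p : StackProg K) : StackProg K :=
  seq (pourOnes a b) (seq (pop a)
    (loop b (· == some true) (seq (pop b) (seq (push b false) (seq p (pop b))))))

theorem runs_countLoop (hab : a ≠ b) {C v : ℕ} {S : K → List Bool} {G : ℕ → K → List Bool}
    {A X : List Bool} (hS : S = update (update (G 0) b X) a (List.replicate v true ++ false :: A))
    (hG : G 0 a = A) (hX : X.head? ≠ some true)
    (hp : ∀ j < v, ∀ Y : List Bool, Y.head? ≠ some true →
      Runs p (update (G j) b Y) C (update (G (j + 1)) b Y)) :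
    Runs (countLoop a b p) S (v * (C + 9) + 3) (update (G v) b X) := by
  set Z := fun j => List.replicate (v - j) true ++ X with hZ
  have hbody (j) (hj : j < v) : Runs (seq (pop b) (seq (push b false) (seq p (pop b))))
      (update (G j) b (Z j)) (C + 3) (update (G (j + 1)) b (Z (j + 1))) := by
    have htail : (Z j).tail = Z (j + 1) := by
      simp only [hZ, replicate_sub_append hj, List.tail_cons]
    have hrun := hp j hj (false :: Z (j + 1)) (by simp)
    exact (Runs.seq (runs_pop rfl) (.seq (runs_push (by simp [htail])) (.seq hrun
      (runs_pop (by simp))))).mono (by omega)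
  have hloop := runs_loop (k := b) (c := (· == some true)) (fun j hj => ?_) ?_ hbody
  · have hpour : Runs (pourOnes a b) S (5 * v + 1) _ :=
      runs_pourOnes hab (S := S) (l := false :: A) (by simp [hS]) (by simp)
    refine (hpour.seq (.seq (runs_pop ?_) hloop)).of_eq (by simp [hZ]) (by lia)
    simp [hS, hZ, update_of_ne hab, update_of_ne hab.symm, update_comm hab, ← hG]
  · simp only [hZ, replicate_sub_append hj, update_self, List.head?_cons, beq_self_eq_true]
  · simpa [hZ] using hX

end StackProg

/-! ### Bounded arithmetic on words -/

/-- A structure in which bounded arithmetic terms are evaluated: an input word, a table of bits and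
the values of the variables in `ν`. -/
structure WordModel (ν : Type) where
  inp : List Bool
  tab : List Bool
  env : ν → ℕ

/-- Arithmetic terms with bounded sums that may read bits of the input word and of the table. The
term `sum x t u` stands for the sum of `u` over the values `x < t`, and `sub` is truncated. -/
inductive WordTerm (ν : Type) : Type
  | var (x : ν)
  | one
  | len
  | add (t u : WordTerm ν)
  | sub (t u : WordTerm ν)
  | mul (t u : WordTerm ν)
  | sum (x : ν) (t u : WordTerm ν)
  | input (t : WordTerm ν)
  | table (t : WordTerm ν)

namespace WordModel

variable {ν : Type} [DecidableEq ν]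

/-- The model in which the variable `x` has the value `j`. -/
def assign (M : WordModel ν) (x : ν) (j : ℕ) : WordModel ν :=
  { M with env := Function.update M.env x j }

/-- Every part of the model has size at most `B`. -/
def SizeLE (M : WordModel ν) (B : ℕ) : Prop :=
  M.inp.length ≤ B ∧ M.tab.length ≤ B ∧ ∀ x, M.env x ≤ B

theorem SizeLE.assign {M : WordModel ν} {B C : ℕ} (h : M.SizeLE B) (hBC : B ≤ C) {j : ℕ}
    (hj : j ≤ C) (x : ν) : (M.assign x j).SizeLE C := by
  refine ⟨h.1.trans hBC, h.2.1.trans hBC, fun y => ?_⟩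
  obtain rfl | hy := eq_or_ne y x
  · simpa [WordModel.assign] using hj
  · simpa [WordModel.assign, hy] using (h.2.2 y).trans hBC

end WordModel

/-- The value of a term. -/
def WordTerm.eval {ν : Type} [DecidableEq ν] : WordTerm ν → WordModel ν → ℕ
  | var x, M => M.env x
  | one, _ => 1
  | len, M => M.inp.length
  | add t u, M => t.eval M + u.eval M
  | sub t u, M => t.eval M - u.eval M
  | mul t u, M => t.eval M * u.eval M
  | sum x t u, M => ∑ j ∈ Finset.range (t.eval M), u.eval (M.assign x j)
  | input t, M => (M.inp.getD (t.eval M) false).toNat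
  | table t, M => (M.tab.getD (t.eval M) false).toNat

/-- The stacks of the machine evaluating terms: the input word, the table, the variables in unary,
the accumulator of values in unary, the stack of saved values, a scratch stack for reading bits
and the table under construction. -/
inductive WordStack (ν : Type) : Type
  | inp
  | tab
  | var (x : ν)
  | acc
  | aux
  | scan
  | new
  deriving DecidableEq, Fintype

/-- The contents of the stacks between two commands. -/
structure WordMemory (ν : Type) extends WordModel ν where
  acc : List Bool
  aux : List Bool
  scan : List Bool
  new : List Bool

namespace WordMemory

open Function StackProg

variable {ν : Type} [DecidableEq ν]

/-- The stacks of bits holding a memory. -/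
@[simp]
def contents (M : WordMemory ν) : WordStack ν → List Bool
  | .inp => M.inp
  | .tab => M.tab
  | .var x => List.replicate (M.env x) true
  | .acc => M.acc
  | .aux => M.aux
  | .scan => M.scan
  | .new => M.new

variable (M : WordMemory ν) (l : List Bool)

@[simp]
theorem update_contents_inp : update M.contents .inp l = { M with inp := l }.contents := by
  funext k; cases k <;> simp

@[simp]
theorem update_contents_tab : update M.contents .tab l = { M with tab := l }.contents := by
  funext k; cases k <;> simp

@[simp]
theorem update_contents_acc : update M.contents .acc l = { M with acc := l }.contents := by
  funext k; cases k <;> simp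

@[simp]
theorem update_contents_aux : update M.contents .aux l = { M with aux := l }.contents := by
  funext k; cases k <;> simp

@[simp]
theorem update_contents_scan : update M.contents .scan l = { M with scan := l }.contents := by
  funext k; cases k <;> simp

@[simp]
theorem update_contents_new : update M.contents .new l = { M with new := l }.contents := by
  funext k; cases k <;> simp

@[simp]
theorem update_contents_var (x : ν) (j : ℕ) :
    update M.contents (.var x) (List.replicate j true) =
      { M with env := update M.env x j }.contents := by
  funext k
  rcases k with _ | _ | y | _ | _ | _ | _
  case var => obtain rfl | hy := eq_or_ne y x <;> simp [*]
  all_goals simp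

@[simp]
theorem update_contents_var_nil (x : ν) :
    update M.contents (.var x) [] = { M with env := update M.env x 0 }.contents :=
  M.update_contents_var x 0

theorem runs_countLoop_acc {p : StackProg (WordStack ν)} {C v : ℕ} {M : ℕ → WordMemory ν}
    {X : List Bool} (hX : X.head? ≠ some true)
    (hp : ∀ j < v, ∀ Y : List Bool, Y.head? ≠ some true →
      Runs p { M j with aux := Y }.contents C { M (j + 1) with aux := Y }.contents) :
    Runs (countLoop .acc .aux p)
      { M 0 with acc := List.replicate v true ++ false :: (M 0).acc, aux := X }.contents
      (v * (C + 9) + 3) { M v with aux := X }.contents := by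
  simpa using runs_countLoop (a := .acc) (b := .aux) (G := fun j => (M j).contents)
    (X := X) (by simp) rfl rfl hX (by simpa using hp)

/-- Runs `p` for the successive values of the variable `x` below the number given by the leading
ones of the accumulator. The old value of `x` is saved. -/
def forRange (x : ν) (p : StackProg (WordStack ν)) : StackProg (WordStack ν) :=
  seq (pourOnes (.var x) .aux) (seq (push .aux false)
    (seq (countLoop .acc .aux (seq p (push (.var x) true)))
      (seq (clear (.var x)) (seq (pop .aux) (pourOnes .aux (.var x))))))

theorem runs_forRange {p : StackProg (WordStack ν)} (x : ν) {C v : ℕ} (M : WordMemory ν)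
    {A N : ℕ → List Bool} (haux : M.aux.head? ≠ some true)
    (hp : ∀ j < v, ∀ X : List Bool, X.head? ≠ some true →
      Runs p { M with env := update M.env x j, acc := A j, aux := X, new := N j }.contents C
        { M with env := update M.env x j, acc := A (j + 1), aux := X, new := N (j + 1) }.contents) :
    Runs (forRange x p)
      { M with acc := List.replicate v true ++ false :: A 0, new := N 0 }.contents
      (v * (C + 12) + 10 * M.env x + 9) { M with acc := A v, new := N v }.contents := by
  let X := false :: (List.replicate (M.env x) true ++ M.aux)
  have hloop := runs_countLoop_acc (p := seq p (push (.var x) true)) (X := X) (C := C + 1) (v := v)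
    (M := fun j => { M with env := update M.env x j, acc := A j, new := N j }) (by simp [X])
    fun j hj X hX => (hp j hj X hX).seq (runs_push (by
      simp [← List.replicate_succ]))
  have hsave := runs_pourOnes (a := WordStack.var x) (b := .aux)
    (S := { M with acc := List.replicate v true ++ false :: A 0, new := N 0 }.contents)
    (v := M.env x) (l := []) (by simp) (by simp) (by simp)
  have hclear := runs_clear (WordStack.var x)
    { M with env := update M.env x v, acc := A v, aux := X, new := N v }.contents
  have hrestore := runs_pourOnes (a := WordStack.aux) (b := .var x)
    (S := { M with
      env := update M.env x 0
      acc := A v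
      aux := List.replicate (M.env x) true ++ M.aux
      new := N v }.contents)
    (v := M.env x) (l := M.aux) (by simp) (by simp) haux
  refine (hsave.seq (.seq (runs_push ?_) (hloop.seq (hclear.seq (.seq (runs_pop ?_)
    hrestore))))).of_eq ?_ ?_
  · simp [X]
  · simp [X]
  · simp
  · simp only [contents, update_self, List.length_replicate]
    lia

/-- Replaces the unary index at the top of the accumulator by the bit of the stack `k` at this
index, in unary. Bits beyond the end of the stack read as zero. -/
def readBit (k : WordStack ν) : StackProg (WordStack ν) :=
  seq (countLoop .acc .aux (move k .scan))
    (seq (ite k (· == some true) (push .acc true) skip) (pour .scan k))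

theorem runs_readBit {k : WordStack ν} (hacc : k ≠ .acc) (haux : k ≠ .aux) (hscan : k ≠ .scan)
    {S : WordStack ν → List Bool} (hS : S .scan = []) (hX : (S .aux).head? ≠ some true) (v : ℕ) :
    Runs (readBit k) (update S .acc (List.replicate v true ++ false :: S .acc)) (18 * v + 7)
      (update S .acc (List.replicate ((S k).getD v false).toNat true ++ S .acc)) := by
  let G := fun j => update (update S k ((S k).drop j)) .scan (((S k).take j).reverse ++ S .scan)
  have hG : G 0 = S := by simp [G]
  have hloop := runs_countLoop (a := .acc) (b := .aux) (p := move k .scan) (C := 4) (v := v)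
    (S := update S .acc (List.replicate v true ++ false :: S .acc)) (G := G) (A := S .acc)
    (by simp) (by simp [hG]) (by simp [hG]) hX fun j _ Y _ => (runs_move hscan _).of_eq (by
      funext i
      by_cases hi : i = k <;> simp [G, update_apply, reverse_take_succ, hi, haux, hscan]
      grind) le_rfl
  have hread : Runs (ite k (· == some true) (push .acc true) skip) (G v) 2
      (update (G v) .acc (List.replicate ((S k).getD v false).toNat true ++ S .acc)) := by
    by_cases hv : (S k)[v]? = some true
    · exact .ite_true (by simp [G, hscan, hv]) (runs_push (by simp [G, hv, hacc.symm]))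
    · have hbit : (S k).getD v false = false := by
        rw [List.getD_eq_getElem?_getD]
        rcases h : (S k)[v]? with _ | _ | _ <;> simp_all
      exact .ite_false (by simp [G, hscan, hv])
        (Runs.skip.of_eq (by simp [G, hbit, hacc.symm, -List.getD_eq_getElem?_getD]) (by simp))
  have hpour := runs_pour (a := WordStack.scan) (b := k) hscan.symm
    (update (G v) .acc (List.replicate ((S k).getD v false).toNat true ++ S .acc))
  have hcount := hloop.change (R' := G v) rfl (by simp [G, haux.symm]) le_rfl
  refine (hcount.seq (hread.seq hpour)).of_eq ?_ ?_
  · funext i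
    by_cases hi : i = k <;> simp [G, update_apply, hS, hi, hacc, hscan]
    grind
  · simp only [G, hS, List.append_nil, ne_eq, reduceCtorEq, not_false_eq_true, update_of_ne,
      update_self, List.length_reverse, List.length_take]
    lia

end WordMemory

/-- The program `p` adds the value of `f` in unary to the accumulator, and both its running time
and this value are at most `c` evaluated at the size of the model. -/
def Computes {ν : Type} [DecidableEq ν] (p : StackProg (WordStack ν)) (c : Polynomial ℕ)
    (f : WordModel ν → ℕ) : Prop :=
  ∀ (M : WordMemory ν) (B : ℕ), M.scan = [] → M.aux.head? ≠ some true → M.SizeLE B →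
    f M.toWordModel ≤ c.eval B ∧ p.Runs M.contents (c.eval B)
      { M with acc := List.replicate (f M.toWordModel) true ++ M.acc }.contents

namespace Computes

open Function Polynomial StackProg WordMemory

variable {ν : Type} [DecidableEq ν] {p q : StackProg (WordStack ν)} {c d : ℕ[X]}
  {f g : WordModel ν → ℕ}

theorem var (x : ν) :
    Computes (seq (pourOnes (.var x) .aux) (loop .aux (· == some true)
      (seq (pop .aux) (seq (push (.var x) true) (push .acc true))))) (9 * X + 2)
      (fun M => M.env x) := by
  intro M B _ haux hB
  have hx := hB.2.2 x
  refine ⟨by simp only [eval_add, eval_mul, eval_X, eval_ofNat]; omega, ?_⟩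
  have hpour := runs_pourOnes (a := WordStack.var x) (b := .aux) (S := M.contents)
    (v := M.env x) (l := []) (by simp) (by simp) (by simp)
  have hloop := runs_loop (k := WordStack.aux) (c := (· == some true)) (v := M.env x) (C := 3)
    (p := seq (pop .aux) (seq (push (.var x) true) (push .acc true)))
    (G := fun j => { M with
      env := update M.env x j
      acc := List.replicate j true ++ M.acc
      aux := List.replicate (M.env x - j) true ++ M.aux }.contents)
    (fun j hj => by simp [replicate_sub_append hj]) (by simpa using haux)
    fun j hj => .seq (runs_pop rfl) (.seq (runs_push rfl) (runs_push (by
      simp [replicate_sub_append hj, ← List.replicate_succ, cons_replicate_append])))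
  refine Runs.of_eq (.seq (hpour.change rfl (by simp) le_rfl) hloop) (by simp) ?_
  simp only [eval_add, eval_mul, eval_X, eval_ofNat]
  omega

theorem one : Computes (push .acc true) 1 (fun _ : WordModel ν => 1) :=
  fun M _ _ _ _ => ⟨by simp, (runs_push rfl).of_eq (by simp) (by simp)⟩

theorem len :
    Computes (seq (loop .inp Option.isSome (seq (move .inp .scan) (push .acc true)))
      (pour .scan .inp)) (11 * X + 2) (fun M : WordModel ν => M.inp.length) := by
  intro M B hscan _ hB
  have hw := hB.1
  refine ⟨by simp only [eval_add, eval_mul, eval_X, eval_ofNat]; omega, ?_⟩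
  have hloop := runs_loop (k := WordStack.inp) (c := Option.isSome) (v := M.inp.length) (C := 5)
    (p := seq (move .inp .scan) (push .acc true))
    (G := fun j => { M with
      inp := M.inp.drop j
      scan := (M.inp.take j).reverse ++ M.scan
      acc := List.replicate j true ++ M.acc }.contents)
    (fun j hj => by simp [hj]) (by simp)
    fun j _ => (runs_move (by simp) _).seq (runs_push (by
      simp [reverse_take_succ, List.replicate_succ]))
  have hpour := runs_pour (a := WordStack.scan) (b := .inp) (by simp)
    { M with
      inp := []
      scan := M.inp.reverse
      acc := List.replicate M.inp.length true ++ M.acc }.contents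
  refine Runs.of_eq (.seq (hloop.change (by simp) (by simp [hscan]) le_rfl) hpour)
    (by simp [hscan]) ?_
  simp only [contents, List.length_reverse, eval_add, eval_mul, eval_X, eval_ofNat]
  omega

theorem add (hp : Computes p c f) (hq : Computes q d g) :
    Computes (seq p q) (c + d) (fun M => f M + g M) := by
  intro M B hscan haux hB
  obtain ⟨hf, hp⟩ := hp M B hscan haux hB
  obtain ⟨hg, hq⟩ := hq { M with acc := List.replicate (f M.toWordModel) true ++ M.acc } B
    hscan haux hB
  refine ⟨by simpa using add_le_add hf hg, (hp.seq hq).of_eq ?_ (by simp)⟩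
  simp [← List.append_assoc, add_comm (f _)]

theorem sub (hp : Computes p c f) (hq : Computes q d g) :
    Computes (seq (push .acc false) (seq p (seq (push .acc false) (seq q
      (seq (countLoop .acc .aux (ite .acc (· == some true) (pop .acc) skip))
        (seq (pourOnes .acc .aux) (seq (pop .acc) (pourOnes .aux .acc))))))))
      (11 * c + 12 * d + 8) (fun M => f M - g M) := by
  intro M B hscan haux hB
  obtain ⟨hf, hp⟩ := hp { M with acc := false :: M.acc } B hscan haux hB
  obtain ⟨hg, hq⟩ := hq
    { M with acc := false :: (List.replicate (f M.toWordModel) true ++ false :: M.acc) } B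
    hscan haux hB
  refine ⟨by simp only [eval_add, eval_mul, eval_ofNat]; lia, ?_⟩
  have hloop := runs_countLoop_acc (p := ite .acc (· == some true) (pop .acc) skip) (C := 2)
    (v := g M.toWordModel) (X := M.aux)
    (M := fun j => { M with
      acc := List.replicate (f M.toWordModel - j) true ++ false :: M.acc }) haux
    fun j _ Y _ => by
      rcases lt_or_ge j (f M.toWordModel) with hj | hj
      · exact .ite_true (by simp [replicate_sub_append hj])
          (runs_pop (by simp [replicate_sub_append hj]))
      · have hzero : f M.toWordModel - (j + 1) = 0 := by omega
        exact .ite_false (by simp [Nat.sub_eq_zero_of_le hj])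
          (Runs.skip.of_eq (by simp [hzero, Nat.sub_eq_zero_of_le hj]) (by simp))
  have hsave := runs_pourOnes (a := WordStack.acc) (b := .aux)
    (S := { M with
      acc := List.replicate (f M.toWordModel - g M.toWordModel) true ++ false :: M.acc }.contents)
    (by simp) rfl (by simp)
  have hrestore := runs_pourOnes (a := WordStack.aux) (b := .acc)
    (S := { M with
      aux := List.replicate (f M.toWordModel - g M.toWordModel) true ++ M.aux }.contents)
    (by simp) rfl haux
  refine Runs.of_eq (.seq (runs_push (by simp)) (.seq hp (.seq (runs_push (by simp)) (.seq hq
    (.seq (hloop.change (by simp) rfl le_rfl) (.seq hsave (.seq (runs_pop (by simp))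
      hrestore))))))) (by simp) ?_
  simp only [eval_add, eval_mul, eval_ofNat]
  lia

theorem mul (hp : Computes p c f) (hq : Computes q d g) :
    Computes (seq (push .acc false) (seq p (countLoop .acc .aux q)))
      (c * (d + 9) + c + 4) (fun M => f M * g M) := by
  intro M B hscan haux hB
  obtain ⟨hf, hp⟩ := hp { M with acc := false :: M.acc } B hscan haux hB
  obtain ⟨hg, -⟩ := hq M B hscan haux hB
  have hfg : f M.toWordModel * g M.toWordModel ≤ c.eval B * d.eval B := Nat.mul_le_mul hf hg
  refine ⟨by simp only [eval_add, eval_mul, eval_ofNat]; lia, ?_⟩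
  have hloop := runs_countLoop_acc (p := q) (C := d.eval B) (v := f M.toWordModel) (X := M.aux)
    (M := fun j => { M with acc := List.replicate (j * g M.toWordModel) true ++ M.acc }) haux
    fun j _ Y hY => (hq { M with
      acc := List.replicate (j * g M.toWordModel) true ++ M.acc
      aux := Y } B hscan hY hB).2.of_eq
      (by simp [← List.append_assoc, add_mul, add_comm (g _)]) le_rfl
  refine Runs.of_eq (.seq (runs_push (by simp)) (.seq hp
    (hloop.change (by simp) rfl le_rfl))) (by simp) ?_
  simp only [eval_add, eval_mul, eval_ofNat]
  nlinarith

theorem sum (x : ν) (hp : Computes p c f) (hq : Computes q d g) :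
    Computes (seq (push .acc false) (seq p (forRange x q)))
      (c * (d.comp (X + c) + 12) + c + 10 * X + 10)
      (fun M => ∑ j ∈ Finset.range (f M), g (M.assign x j)) := by
  intro M B hscan haux hB
  obtain ⟨hf, hp⟩ := hp { M with acc := false :: M.acc } B hscan haux hB
  have hsize (j) (hj : j < f M.toWordModel) : (M.assign x j).SizeLE (B + c.eval B) :=
    hB.assign (Nat.le_add_right _ _) (hj.le.trans (hf.trans (Nat.le_add_left _ _))) x
  have hloop := runs_forRange (p := q) (C := d.eval (B + c.eval B)) (v := f M.toWordModel) x M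
    (A := fun v => List.replicate (∑ j ∈ Finset.range v, g (M.assign x j)) true ++ M.acc)
    (N := fun _ => M.new) haux fun j hj Y hY =>
      (hq { M with
        env := update M.env x j
        acc := List.replicate (∑ j ∈ Finset.range j, g (M.assign x j)) true ++ M.acc
        aux := Y } _ hscan hY (hsize j hj)).2.of_eq
      (by simp [← List.append_assoc, Finset.sum_range_succ, add_comm (g _), WordModel.assign])
      le_rfl
  have hx := hB.2.2 x
  have hsum : ∑ j ∈ Finset.range (f M.toWordModel), g (M.assign x j) ≤
      f M.toWordModel * d.eval (B + c.eval B) := by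
    refine (Finset.sum_le_card_nsmul _ _ (d.eval (B + c.eval B)) fun j hj => ?_).trans_eq (by simp)
    exact (hq { M with env := update M.env x j } _ hscan haux
      (hsize j (Finset.mem_range.1 hj))).1
  refine ⟨?_, Runs.of_eq (.seq (runs_push (by simp)) (.seq hp
    (hloop.change (by simp) rfl le_rfl))) (by simp) ?_⟩
  all_goals
    simp only [eval_add, eval_mul, eval_comp, eval_X, eval_ofNat]
    nlinarith

theorem bit {k : WordStack ν} {b : WordModel ν → List Bool} (hacc : k ≠ .acc) (haux : k ≠ .aux)
    (hscan : k ≠ .scan) (hb : ∀ M : WordMemory ν, M.contents k = b M.toWordModel)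
    (hp : Computes p c f) :
    Computes (seq (push .acc false) (seq p (readBit k))) (19 * c + 8)
      (fun M => ((b M).getD (f M) false).toNat) := by
  intro M B hM hX hB
  obtain ⟨hf, hp⟩ := hp { M with acc := false :: M.acc } B hM hX hB
  have hread := runs_readBit hacc haux hscan (S := M.contents) hM hX (f M.toWordModel)
  rw [hb] at hread
  refine ⟨(Bool.toNat_le _).trans (by simp), Runs.of_eq (.seq (runs_push (by simp))
    (.seq hp (hread.change (by simp) rfl le_rfl))) (by simp) ?_⟩
  simp only [eval_add, eval_mul, eval_ofNat]
  lia

end Computes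

theorem WordTerm.exists_computes {ν : Type} [DecidableEq ν] (t : WordTerm ν) :
    ∃ p c, Computes p c t.eval := by
  induction t with
  | var x => exact ⟨_, _, .var x⟩
  | one => exact ⟨_, _, .one⟩
  | len => exact ⟨_, _, .len⟩
  | add t u ht hu =>
    obtain ⟨⟨_, _, ht⟩, _, _, hu⟩ := And.intro ht hu
    exact ⟨_, _, ht.add hu⟩
  | sub t u ht hu =>
    obtain ⟨⟨_, _, ht⟩, _, _, hu⟩ := And.intro ht hu
    exact ⟨_, _, ht.sub hu⟩
  | mul t u ht hu =>
    obtain ⟨⟨_, _, ht⟩, _, _, hu⟩ := And.intro ht hu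
    exact ⟨_, _, ht.mul hu⟩
  | sum x t u ht hu =>
    obtain ⟨⟨_, _, ht⟩, _, _, hu⟩ := And.intro ht hu
    exact ⟨_, _, ht.sum x hu⟩
  | input t ht =>
    obtain ⟨_, _, ht⟩ := ht
    exact ⟨_, _, ht.bit (k := .inp) nofun nofun nofun fun _ => rfl⟩
  | table t ht =>
    obtain ⟨_, _, ht⟩ := ht
    exact ⟨_, _, ht.bit (k := .tab) nofun nofun nofun fun _ => rfl⟩

theorem WordModel.sizeLE_mk {ν : Type} {w H : List Bool} {C : ℕ} (hH : H.length ≤ C) :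
    (WordModel.mk w H fun _ : ν => 0).SizeLE (w.length + C) :=
  ⟨Nat.le_add_right _ _, hH.trans (Nat.le_add_left _ _), fun _ => Nat.zero_le _⟩

namespace WordTerm

variable {ν : Type} [DecidableEq ν]

/-- Terms are used as formulas: they hold if their value is positive. -/
def Holds (t : WordTerm ν) (M : WordModel ν) : Prop :=
  0 < t.eval M

instance (t : WordTerm ν) (M : WordModel ν) : Decidable (t.Holds M) :=
  inferInstanceAs (Decidable (0 < t.eval M))

/-- The `d`-th power of the length of the input word. -/
def lenPow : ℕ → WordTerm ν
  | 0 => one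
  | d + 1 => mul (lenPow d) len

theorem eval_lenPow (d : ℕ) (M : WordModel ν) :
    (lenPow d : WordTerm ν).eval M = M.inp.length ^ d := by
  induction d with
  | zero => rfl
  | succ d ih => rw [lenPow, eval, ih, eval, pow_succ]

/-- The operator on tables defined by the formula `φ`: the new table has `w.length ^ d` bits, and
its bit `j` says whether `φ` holds for the value `j` of `x`. -/
def nextTable (d : ℕ) (x : ν) (φ : WordTerm ν) (w H : List Bool) : List Bool :=
  (List.range (w.length ^ d)).map fun j =>
    decide (φ.Holds (WordModel.assign ⟨w, H, fun _ => 0⟩ x j))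

theorem getD_nextTable {d j : ℕ} {x : ν} {φ : WordTerm ν}
    {w H : List Bool} (hj : j < w.length ^ d) :
    (nextTable d x φ w H).getD j false = true ↔
      φ.Holds (WordModel.assign ⟨w, H, fun _ => 0⟩ x j) := by
  rw [nextTable, List.getD_eq_getElem _ _ (by simpa using hj), List.getElem_map,
    List.getElem_range, decide_eq_true_eq]

/-- The table obtained from the empty one by `w.length ^ d` applications of `nextTable`. -/
def iteratedTable (d : ℕ) (x : ν) (φ : WordTerm ν) (w : List Bool) : List Bool :=
  (nextTable d x φ w)^[w.length ^ d] []

theorem length_nextTable_iterate_le (d : ℕ) (x : ν) (φ : WordTerm ν) (w : List Bool) (j : ℕ) :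
    ((nextTable d x φ w)^[j] []).length ≤ w.length ^ d := by
  cases j with
  | zero => simp
  | succ j => simp [Function.iterate_succ_apply', nextTable]

end WordTerm

namespace WordMemory

open Function StackProg WordTerm Polynomial

variable {ν : Type} [DecidableEq ν] {p q r : StackProg (WordStack ν)} {c b e : ℕ[X]}
  {t φ ψ : WordTerm ν}

/-- Pushes the truth value of the formula evaluated by `p` onto the new table. -/
def writeBit (p : StackProg (WordStack ν)) : StackProg (WordStack ν) :=
  seq p (seq (ite .acc (· == some true) (push .new true) (push .new false)) (clear .acc))

theorem runs_writeBit (hp : Computes p c t.eval) {M : WordMemory ν} {B : ℕ} (hacc : M.acc = [])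
    (hscan : M.scan = []) (haux : M.aux.head? ≠ some true) (hB : M.SizeLE B) :
    Runs (writeBit p) M.contents (3 * c.eval B + 3)
      { M with new := decide (t.Holds M.toWordModel) :: M.new }.contents := by
  obtain ⟨hle, hp⟩ := hp M B hscan haux hB
  have hbit : Runs (ite .acc (· == some true) (push .new true) (push .new false))
      { M with acc := List.replicate (t.eval M.toWordModel) true ++ M.acc }.contents 2
      { M with
        acc := List.replicate (t.eval M.toWordModel) true ++ M.acc
        new := decide (t.Holds M.toWordModel) :: M.new }.contents := by
    rcases ht : t.eval M.toWordModel with _ | v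
    · exact .ite_false (by simp [hacc]) (runs_push (by simp [Holds, ht]))
    · exact .ite_true (by simp [List.replicate_succ]) (runs_push (by simp [Holds, ht]))
  refine Runs.of_eq (.seq hp (.seq hbit (runs_clear _ _))) (by simp [hacc]) ?_
  simp only [contents, hacc, List.append_nil, List.length_replicate]
  omega

/-- Replaces the table by the one defined by the formula evaluated by `p`, where `r` computes the
number of its bits. -/
def replaceTable (x : ν) (p r : StackProg (WordStack ν)) : StackProg (WordStack ν) :=
  seq (push .acc false) (seq r (seq (forRange x (writeBit p)) (seq (clear .tab) (pour .new .tab))))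

theorem runs_replaceTable {d : ℕ} (x : ν) (hp : Computes p c φ.eval)
    (hr : Computes r b (lenPow d).eval) {w H X : List Bool} (hH : H.length ≤ w.length ^ d)
    (hX : X.head? ≠ some true) :
    Runs (replaceTable x p r) (contents ⟨⟨w, H, fun _ => 0⟩, [], X, [], []⟩)
      (w.length ^ d * (3 * c.eval (w.length + w.length ^ d) + 22) +
        b.eval (w.length + w.length ^ d) + 12)
      (contents ⟨⟨w, nextTable d x φ w H, fun _ => 0⟩, [], X, [], []⟩) := by
  set M : WordMemory ν := ⟨⟨w, H, fun _ => 0⟩, [], X, [], []⟩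
  have hB : M.SizeLE _ := WordModel.sizeLE_mk hH
  obtain ⟨-, hr⟩ := hr { M with acc := [false] } _ rfl hX hB
  rw [eval_lenPow] at hr
  have hloop := runs_forRange (p := writeBit p) (v := w.length ^ d) x M (A := fun _ => [])
    (N := fun j => ((List.range j).map fun i => decide (φ.Holds (M.assign x i))).reverse) hX
    fun j hj Y hY => (runs_writeBit hp (M := { M with
      env := update M.env x j
      aux := Y
      new := ((List.range j).map fun i => decide (φ.Holds (M.assign x i))).reverse }) rfl rfl hY
      (hB.assign le_rfl (hj.le.trans (Nat.le_add_left _ _)) x)).of_eq (by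
        rw [List.range_succ, List.map_append, List.reverse_append]; rfl) le_rfl
  have hclear := runs_clear WordStack.tab
    { M with new := (nextTable d x φ w H).reverse }.contents
  have hpour := runs_pour (a := WordStack.new) (b := .tab) (by simp)
    { M with tab := [], new := (nextTable d x φ w H).reverse }.contents
  refine Runs.of_eq (.seq (runs_push (by simp [M])) (.seq hr (.seq (hloop.change (by simp [M])
    rfl le_rfl) (.seq hclear (hpour.change (by simp) rfl le_rfl))))) (by simp [M]) ?_
  simp only [M, contents, nextTable, List.length_reverse, List.length_map, List.length_range]
  lia

/-- Computes the iterated table and decides the formula evaluated by `q` in it. -/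
def decideTable (x : ν) (p q r : StackProg (WordStack ν)) : StackProg (WordStack ν) :=
  seq (push .acc false) (seq r (seq (countLoop .acc .aux (replaceTable x p r))
    (seq (writeBit q) (seq (clear .inp) (clear .tab)))))

theorem runs_decideTable {d : ℕ} (x : ν) (hp : Computes p c φ.eval) (hq : Computes q e ψ.eval)
    (hr : Computes r b (lenPow d).eval) (w : List Bool) :
    Runs (decideTable x p q r) (update (fun _ => []) .inp w)
      (((X * (X * (3 * c + 22) + b + 21) + b + 3 * e + 4 * X + 9).comp
        (X + X ^ d)).eval w.length)
      (update (fun _ => []) .new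
        [decide (ψ.Holds ⟨w, iteratedTable d x φ w, fun _ => 0⟩)]) := by
  set H := fun j => (nextTable d x φ w)^[j] []
  set M : ℕ → WordMemory ν := fun j => ⟨⟨w, H j, fun _ => 0⟩, [], [], [], []⟩
  have hlen (j) : (H j).length ≤ w.length ^ d := length_nextTable_iterate_le d x φ w j
  have hB (j) : (M j).SizeLE _ := WordModel.sizeLE_mk (hlen j)
  obtain ⟨-, hrun⟩ := hr { M 0 with acc := [false] } _ rfl (by simp [M]) (hB 0)
  rw [eval_lenPow] at hrun
  have hloop := runs_countLoop_acc (M := M) (v := w.length ^ d) (X := []) (by simp)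
    fun j _ Y hY => (runs_replaceTable x hp hr (hlen j) hY).of_eq
      (by simp only [M, H, iterate_succ_apply']) le_rfl
  have hanswer := runs_writeBit hq (M := M (w.length ^ d)) rfl rfl (by simp [M]) (hB _)
  have hinp := runs_clear WordStack.inp { M (w.length ^ d) with
    new := [decide (ψ.Holds (M (w.length ^ d)).toWordModel)] }.contents
  have htab := runs_clear WordStack.tab { M (w.length ^ d) with
    inp := []
    new := [decide (ψ.Holds (M (w.length ^ d)).toWordModel)] }.contents
  refine Runs.change (.seq (runs_push (S := (M 0).contents) (by simp [M])) (.seq hrun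
    (.seq (hloop.change (by simp [M]) (by simp [M]) le_rfl) (.seq hanswer
      (.seq (hinp.change (by simp [M]) (by simp) le_rfl) htab))))) ?_ ?_ ?_
  · funext k; cases k <;> simp [M, H]
  · funext k; cases k <;> rfl
  · have hN : w.length ^ d ≤ w.length + w.length ^ d := Nat.le_add_left _ _
    have hmul (K L : ℕ) := Nat.mul_le_mul hN (Nat.add_le_add_right (Nat.mul_le_mul_right K hN) L)
    have hH := hlen (w.length ^ d)
    simp only [M, contents, add_comp, mul_comp, X_comp, ofNat_comp, Nat.cast_ofNat, eval_add,
      eval_mul, eval_X, eval_pow, eval_ofNat, eval_comp]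
    linarith [hmul (3 * c.eval (w.length + w.length ^ d) + 22)
      (b.eval (w.length + w.length ^ d) + 21)]

end WordMemory

open Classical in
theorem StackProg.nonempty_polyTimeDecider {K : Type} [DecidableEq K] [Finite K]
    {L : Set (List Bool)} {p : StackProg K} {k₀ k₁ : K} {T : Polynomial ℕ}
    (hp : ∀ w, p.Runs (Function.update (fun _ => []) k₀ w) (T.eval w.length)
      (Function.update (fun _ => []) k₁ [decide (w ∈ L)])) :
    Nonempty (PolyTimeDecider L) := by
  have := Fintype.ofFinite K
  refine ⟨{
    tm := p.machine k₀ k₁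
    inputAlphabet := Equiv.refl Bool
    outputAlphabet := Equiv.refl Bool
    time := T + 1
    outputsFun := fun w => Classical.choice ?_ }⟩
  have hid (l) (hl : l = w) : Nonempty (Turing.TM2OutputsInTime (p.machine k₀ k₁) l
      (some [decide (w ∈ L)]) ((T + 1).eval w.length)) := by
    rw [hl, Polynomial.eval_add, Polynomial.eval_one]
    exact (hp w).outputsInTime
  exact hid _ (List.map_id w)

theorem WordTerm.nonempty_polyTimeDecider {ν : Type} [DecidableEq ν] [Finite ν] (d : ℕ) (x : ν)
    (φ ψ : WordTerm ν) :
    Nonempty (PolyTimeDecider {w | ψ.Holds ⟨w, iteratedTable d x φ w, fun _ => 0⟩}) := by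
  have := Fintype.ofFinite ν
  obtain ⟨p, c, hp⟩ := φ.exists_computes
  obtain ⟨q, e, hq⟩ := ψ.exists_computes
  obtain ⟨r, b, hr⟩ := (lenPow d : WordTerm ν).exists_computes
  exact StackProg.nonempty_polyTimeDecider fun w =>
    (WordMemory.runs_decideTable x hp hq hr w).of_eq (by congr) le_rfl

/-! ### Homing of pairs of states -/

theorem isFixedPt_iterate_empty {α : Type*} [Finite α] {F : Set α → Set α} (hF : Monotone F)
    {j : ℕ} (hj : Nat.card α ≤ j) : Function.IsFixedPt F (F^[j] ∅) := by
  have hmono : Monotone fun i => F^[i] ∅ := hF.monotone_iterate_of_le_map (Set.empty_subset _)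
  have hcard : Monotone fun i => (F^[i] ∅).ncard := fun a b hab =>
    Set.ncard_le_ncard (hmono hab)
  have heq (i) (h : (F^[i] ∅).ncard = (F^[i + 1] ∅).ncard) : F^[i] ∅ = F^[i + 1] ∅ :=
    Set.eq_of_subset_of_ncard_le (hmono i.le_succ) h.ge
  have hstab := fun n => Nat.stabilises_of_monotone (n := n) hcard
    (fun i => Set.ncard_le_card (F^[i] ∅)) fun i hi => by
      rw [Function.iterate_succ_apply' F (i + 1), ← heq i hi, ← Function.iterate_succ_apply' F,
        hi]
  rw [Function.IsFixedPt, ← Function.iterate_succ_apply' F]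
  exact (heq j ((hstab j hj).trans (hstab (j + 1) (hj.trans j.le_succ)).symm)).symm

namespace FSM

/-- An adaptive experiment can bring the machine to a known state if it is started in `s` or `t`:
it merges the two states or tells them apart. -/
inductive PairHoming {S I O : Type*} (M : FSM S I O) : S → S → Prop
  | refl (s : S) : M.PairHoming s s
  | step {s t : S} (i : I)
      (h : ∀ o s' t', M.trans s i o s' → M.trans t i o t' → M.PairHoming s' t') :
      M.PairHoming s t

section

variable {S I O Q : Type*} {M : FSM S I O}

theorem Observable.successor_cons (hM : M.Observable) {s s' : S} {i : I} {o : O}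
    (h : M.trans s i o s') (γ : List (I × O)) :
    M.successor s ((i, o) :: γ) = M.successor s' γ := by
  ext t
  constructor
  · rintro ⟨u, hu, ht⟩
    obtain rfl := hM _ _ _ _ _ h hu
    exact ht
  · exact fun ht => ⟨s', h, ht⟩

theorem Acyclic.wellFounded [Finite Q] {P : FSM Q I O} (hP : P.Acyclic) :
    WellFounded fun q p => P.Edge p q := by
  have : IsTrans Q (fun q p => Relation.TransGen P.Edge p q) := ⟨fun _ _ _ h h' => h'.trans h⟩
  have : Std.Irrefl (fun q p => Relation.TransGen P.Edge p q) := ⟨hP⟩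
  exact Subrelation.wf (fun h => Relation.TransGen.single h)
    (Finite.wellFounded_of_trans_of_irrefl fun q p => Relation.TransGen P.Edge p q)

theorem IsTestCase.pairHoming {P : FSM Q I O} {p₀ : Q} (hP : P.IsTestCase p₀)
    (hM : M.Observable) (p : Q) : ∀ s t : S, P.IsHomingFor p M {s, t} → M.PairHoming s t := by
  have := hP.finite
  induction p using hP.acyclic.wellFounded.induction with
  | _ p ih =>
    intro s t h
    by_cases hd : P.Deadlock p
    · obtain ⟨u, hu⟩ := h [] p rfl hd
      have key : ∀ s' ∈ ({s, t} : Set S), s' = u := by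
        intro s' hs'
        have hself : s' ∈ M.successor s' [] := rfl
        rcases hu s' hs' with h | h
        · simp [h] at hself
        · simpa [h] using hself
      obtain rfl := key s (by simp)
      obtain rfl := key t (by simp)
      exact .refl _
    · simp only [Deadlock, not_forall, not_not] at hd
      obtain ⟨i, hi⟩ := hd
      refine .step i fun o s' t' hs ht => ?_
      obtain ⟨p', hp'⟩ := hP.outputComplete p i hi o
      refine ih p' ⟨i, o, hp'⟩ s' t' fun γ d hγ hd => ?_
      obtain ⟨u, hu⟩ := h ((i, o) :: γ) d ⟨p', hp', hγ⟩ hd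
      refine ⟨u, ?_⟩
      rintro x (rfl | rfl)
      · simpa [hM.successor_cons hs] using hu s (by simp)
      · simpa [hM.successor_cons ht] using hu t (by simp)

theorem AdaptivelyHoming.pairHoming (h : M.AdaptivelyHoming) (hM : M.Observable) (s t : S) :
    M.PairHoming s t := by
  obtain ⟨Q, P, p₀, hP, hh⟩ := h
  refine hP.pairHoming hM p₀ s t fun γ d hγ hd => ?_
  obtain ⟨u, hu⟩ := hh γ d hγ hd
  exact ⟨u, fun s' _ => hu s' trivial⟩

end

/-- Adaptive experiments as trees branching over the outputs. -/
inductive Experiment (I O : Type) : Type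
  | leaf
  | apply (i : I) (next : O → Experiment I O)

namespace Experiment

variable {I O : Type}

/-- The machine whose states are all experiments; a transition applies the next input and observes
an output. -/
def machine (I O : Type) : FSM (Experiment I O) I O where
  trans x i o y := ∃ next, x = apply i next ∧ y = next o

theorem machine_edge_apply {i : I} {next : O → Experiment I O} {y : Experiment I O} :
    (machine I O).Edge (apply i next) y ↔ ∃ o, y = next o := by
  constructor
  · rintro ⟨j, o, next', h, rfl⟩
    cases h
    exact ⟨o, rfl⟩
  · rintro ⟨o, rfl⟩
    exact ⟨i, o, next, rfl, rfl⟩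

theorem not_machine_edge_leaf {y : Experiment I O} : ¬ (machine I O).Edge leaf y := by
  rintro ⟨j, o, next', h, -⟩
  cases h

theorem machine_acyclic : (machine I O).Acyclic := by
  have hwf : WellFounded fun q p => (machine I O).Edge p q := by
    refine ⟨fun x => ?_⟩
    induction x with
    | leaf => exact ⟨_, fun y hy => absurd hy not_machine_edge_leaf⟩
    | apply i next ih =>
      refine ⟨_, fun y hy => ?_⟩
      obtain ⟨o, rfl⟩ := machine_edge_apply.1 hy
      exact ih o
  intro x hx
  rw [← Relation.transGen_swap] at hx
  exact hwf.transGen.irrefl.irrefl x hx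

theorem finite_reachable [Finite O] (x : Experiment I O) :
    {y | Relation.ReflTransGen (machine I O).Edge x y}.Finite := by
  induction x with
  | leaf =>
    refine (Set.finite_singleton leaf).subset fun y hy => ?_
    rcases Relation.ReflTransGen.cases_head hy with h | ⟨z, hz, -⟩
    · exact h.symm
    · exact absurd hz not_machine_edge_leaf
  | apply i next ih =>
    refine ((Set.finite_singleton (apply i next)).union (Set.finite_iUnion ih)).subset
      fun y hy => ?_
    rcases Relation.ReflTransGen.cases_head hy with h | ⟨z, hz, hzy⟩
    · exact Or.inl h.symm
    · obtain ⟨o, rfl⟩ := machine_edge_apply.1 hz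
      exact Or.inr (Set.mem_iUnion.2 ⟨o, hzy⟩)

/-- The states of the test case of the experiment `x`: what may remain of `x` to be done. -/
abbrev Node (x : Experiment I O) : Type :=
  {y // Relation.ReflTransGen (machine I O).Edge x y}

/-- The experiment `x` as a test case. -/
def testCase (x : Experiment I O) : FSM x.Node I O where
  trans y i o z := (machine I O).trans y.1 i o z.1

/-- The initial state of `x.testCase`. -/
def root (x : Experiment I O) : x.Node := ⟨x, .refl⟩

theorem isTestCase [Finite O] (x : Experiment I O) : x.testCase.IsTestCase x.root where
  finite := (finite_reachable x).to_subtype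
  initiallyConnected := by
    rintro ⟨y, hy⟩
    induction hy with
    | refl => exact .refl
    | tail h₁ h₂ ih => exact ih.tail h₂
  singleInput := by
    rintro y i j ⟨o, z, next, h, -⟩ ⟨o', z', next', h', -⟩
    rw [h] at h'
    cases h'
    rfl
  outputComplete := by
    rintro y i ⟨o, z, next, h, -⟩ o'
    exact ⟨⟨next o', y.2.tail ⟨i, o', next, h, rfl⟩⟩, next, h, rfl⟩
  observable := by
    rintro y i o z z' ⟨next, h, hz⟩ ⟨next', h', hz'⟩
    rw [h] at h'
    cases h'
    exact Subtype.ext (hz.trans hz'.symm)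
  acyclic := fun y hy => machine_acyclic y.1 (hy.lift Subtype.val fun _ _ h => h)

variable {S : Type*} (M : FSM S I O)

/-- The states after the response `o` to the input `i` in a state in `A`. -/
def after (A : Set S) (i : I) (o : O) : Set S := {s' | ∃ s ∈ A, M.trans s i o s'}

/-- The experiment brings the machine from each state in `A` to a known state. -/
def Homes : Experiment I O → Set S → Prop
  | leaf, A => ∃ s, A ⊆ {s}
  | apply i next, A => ∀ o, Homes (next o) (after M A i o)

variable {M}

theorem Homes.exists_of_reaches (hM : M.Observable) {x : Experiment I O} [Nonempty O]
    (γ : List (I × O)) : ∀ (y d : x.Node) (A : Set S), Homes M y.1 A →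
      x.testCase.Reaches y γ d → x.testCase.Deadlock d →
      ∃ s, ∀ s' ∈ A, M.successor s' γ = ∅ ∨ M.successor s' γ = {s} := by
  induction γ with
  | nil =>
    rintro ⟨y, hy⟩ d A hA rfl hd
    cases y with
    | leaf =>
      obtain ⟨s, hs⟩ := hA
      refine ⟨s, fun s' hs' => Or.inr ?_⟩
      obtain rfl := hs hs'
      ext t
      exact eq_comm
    | apply i next =>
      obtain ⟨o⟩ := ‹Nonempty O›
      exact absurd ⟨o, ⟨next o, hy.tail ⟨i, o, next, rfl, rfl⟩⟩, next, rfl, rfl⟩ (hd i)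
  | cons io γ ih =>
    rintro ⟨y, hy⟩ d A hA ⟨u, ⟨next, hyn, hu⟩, hr⟩ hd
    simp only at hyn
    subst hyn
    obtain ⟨s, hs⟩ := ih u d (after M A io.1 io.2) (hu ▸ hA io.2) hr hd
    refine ⟨s, fun s' hs' => ?_⟩
    by_cases hex : ∃ t, M.trans s' io.1 io.2 t
    · obtain ⟨t, ht⟩ := hex
      rw [show io :: γ = (io.1, io.2) :: γ from rfl, hM.successor_cons ht]
      exact hs t ⟨s', hs', ht⟩
    · refine Or.inl (Set.eq_empty_of_forall_notMem ?_)
      rintro t ⟨v, hv, -⟩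
      exact hex ⟨v, hv⟩

theorem Homes.homingSet [Finite O] [Nonempty O] (hM : M.Observable) {x : Experiment I O}
    {A : Set S} (h : Homes M x A) : M.HomingSet A :=
  ⟨x.Node, x.testCase, x.root, x.isTestCase, fun γ d hγ hd =>
    h.exists_of_reaches hM γ x.root d A hγ hd⟩

theorem ncard_after_le [Finite S] (hM : M.Observable) (A : Set S) (i : I) (o : O) :
    (after M A i o).ncard ≤ A.ncard := by
  choose! g hg using fun (s' : S) (h : s' ∈ after M A i o) => h
  exact Set.ncard_le_ncard_of_injOn g (fun s' h => (hg s' h).1)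
    fun s' h t' h' e => hM _ _ _ _ _ (hg s' h).2 (e ▸ (hg t' h').2)

theorem ncard_after_lt [Finite S] (hM : M.Observable) {A : Set S} {i : I} {o : O} {s t : S}
    (hs : s ∈ A) (ht : t ∈ A) (hst : s ≠ t)
    (h : ∀ s' t', M.trans s i o s' → M.trans t i o t' → s' = t') :
    (after M A i o).ncard < A.ncard := by
  choose! g hg using fun (s' : S) (h : s' ∈ after M A i o) => h
  obtain ⟨a, ha, hga⟩ : ∃ a ∈ A, ∀ s' ∈ after M A i o, g s' ≠ a := by
    by_contra! hcon
    obtain ⟨s', hs', rfl⟩ := hcon s hs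
    obtain ⟨t', ht', rfl⟩ := hcon t ht
    exact hst (congrArg g (h s' t' (hg s' hs').2 (hg t' ht').2))
  refine lt_of_le_of_lt (b := (A \ {a}).ncard) ?_ (Set.ncard_sdiff_singleton_lt_of_mem ha)
  exact Set.ncard_le_ncard_of_injOn g (fun s' h => ⟨(hg s' h).1, hga s' h⟩)
    fun s' h t' h' e => hM _ _ _ _ _ (hg s' h).2 (e ▸ (hg t' h').2)

theorem exists_homes_of_pairHoming [Finite S] (hM : M.Observable) {c : ℕ}
    (hc : ∀ B : Set S, B.ncard < c → ∃ x, Homes M x B) {s t : S} (h : M.PairHoming s t) :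
    ∀ A : Set S, A.ncard ≤ c → s ∈ A → t ∈ A → s ≠ t → ∃ x, Homes M x A := by
  induction h with
  | refl => exact fun _ _ _ _ h => absurd rfl h
  | @step s t i _ ih =>
    intro A hA hs ht hst
    have key (o : O) : ∃ x, Homes M x (after M A i o) := by
      by_cases hd : ∃ s' t', M.trans s i o s' ∧ M.trans t i o t' ∧ s' ≠ t'
      · obtain ⟨s', t', hs', ht', hne⟩ := hd
        exact ih o s' t' hs' ht' _ ((ncard_after_le hM A i o).trans hA) ⟨s, hs, hs'⟩ ⟨t, ht, ht'⟩
          hne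
      · push Not at hd
        exact hc _ ((ncard_after_lt hM hs ht hst hd).trans_le hA)
    choose next hnext using key
    exact ⟨apply i next, hnext⟩

theorem exists_homes [Finite S] [Nonempty S] (hM : M.Observable) (h : ∀ s t, M.PairHoming s t)
    (c : ℕ) : ∀ A : Set S, A.ncard ≤ c → ∃ x, Homes M x A := by
  induction c with
  | zero =>
    intro A hA
    obtain ⟨s⟩ := ‹Nonempty S›
    have : A = ∅ := (Set.ncard_eq_zero).1 (by omega)
    exact ⟨leaf, s, by simp [this]⟩
  | succ c ih =>
    intro A hA
    by_cases hsub : A.Subsingleton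
    · rcases hsub.eq_empty_or_singleton with rfl | ⟨s, rfl⟩
      · exact ih ∅ (by simp)
      · exact ⟨leaf, s, subset_rfl⟩
    · rw [Set.not_subsingleton_iff] at hsub
      obtain ⟨s, hs, t, ht, hst⟩ := hsub
      exact exists_homes_of_pairHoming hM (fun B hB => ih B (by omega)) (h s t) A hA hs ht hst

end Experiment

theorem adaptivelyHoming_iff {S : Type*} {I O : Type} {M : FSM S I O} [Finite S] [Nonempty S]
    [Finite O] [Nonempty O] (hM : M.Observable) :
    M.AdaptivelyHoming ↔ ∀ s t, M.PairHoming s t := by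
  refine ⟨fun h => h.pairHoming hM, fun h => ?_⟩
  obtain ⟨x, hx⟩ := Experiment.exists_homes hM h _ Set.univ le_rfl
  exact hx.homingSet hM

theorem AdaptivelyHoming.nonempty {S : Type*} {I O : Type} {M : FSM S I O}
    (h : M.AdaptivelyHoming) : Nonempty S := by
  obtain ⟨Q, P, p₀, hP, hh⟩ := h
  have := hP.finite
  have key (p : Q) : ∃ d, P.Deadlock d ∧ ∃ γ, P.Reaches p γ d := by
    induction p using hP.acyclic.wellFounded.induction with
    | _ p ih =>
      by_cases hd : P.Deadlock p
      · exact ⟨p, hd, [], rfl⟩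
      · simp only [Deadlock, not_forall, not_not] at hd
        obtain ⟨i, o, p', hp'⟩ := hd
        obtain ⟨d, hd, γ, hγ⟩ := ih p' ⟨i, o, hp'⟩
        exact ⟨d, hd, (i, o) :: γ, p', hp', hγ⟩
  obtain ⟨d, hd, γ, hγ⟩ := key p₀
  obtain ⟨s, -⟩ := hh γ d hγ hd
  exact ⟨s⟩

section PairStep

variable {S I O : Type*} (M : FSM S I O)

/-- The operator on sets of pairs of states whose least fixed point is `PairHoming`. -/
def pairStep (R : Set (S × S)) : Set (S × S) :=
  {p | p.1 = p.2 ∨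
    ∃ i, ∀ o s' t', M.trans p.1 i o s' → M.trans p.2 i o t' → (s', t') ∈ R}

theorem pairStep_mono : Monotone M.pairStep := by
  rintro R R' hR p (hp | ⟨i, hi⟩)
  · exact .inl hp
  · exact .inr ⟨i, fun o s' t' hs ht => hR (hi o s' t' hs ht)⟩

theorem pairHoming_iff_mem_iterate [Finite S] {j : ℕ} (hj : Nat.card (S × S) ≤ j) {s t : S} :
    M.PairHoming s t ↔ (s, t) ∈ M.pairStep^[j] ∅ := by
  constructor
  · intro h
    have hfix := isFixedPt_iterate_empty M.pairStep_mono hj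
    induction h with
    | refl s => exact hfix ▸ Or.inl rfl
    | step i _ ih => exact hfix ▸ Or.inr ⟨i, ih⟩
  · clear hj
    induction j generalizing s t with
    | zero => exact False.elim
    | succ j ih =>
      rw [Function.iterate_succ_apply']
      rintro (h | ⟨i, hi⟩)
      · obtain rfl : s = t := h
        exact .refl s
      · exact .step i fun o s' t' hs ht => ih (hi o s' t' hs ht)

end PairStep

end FSM

/-! ### Codes of machines -/

theorem replicate_append_inj {n n' : ℕ} {v v' : List Bool} :
    List.replicate n true ++ false :: v = List.replicate n' true ++ false :: v' ↔
      n = n' ∧ v = v' := by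
  induction n generalizing n' with
  | zero => cases n' <;> simp [List.replicate_succ]
  | succ n ih => cases n' <;> simp [List.replicate_succ, ih]

theorem getD_drop {α : Type*} (l : List α) (a j : ℕ) (d : α) :
    (l.drop a).getD j d = l.getD (a + j) d := by
  simp [List.getD_eq_getElem?_getD]

theorem eq_replicate_append_iff {w v : List Bool} {n : ℕ} :
    w = List.replicate n true ++ false :: v ↔ n < w.length ∧
      ((∀ x < n, w.getD x false = true) ∧ w.getD n false = false) ∧ w.drop (n + 1) = v := by
  induction n generalizing w with
  | zero => cases w <;> simp
  | succ n ih =>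
    cases w
    · simp
    · rw [Nat.forall_lt_succ_left]
      simp [List.replicate_succ, ih, and_assoc, and_left_comm]

theorem getD_flatMap {α : Type*} {g : α → List Bool} {c : ℕ} (hg : ∀ a, (g a).length = c)
    {r : ℕ} (hr : r < c) (l : List α) :
    ∀ (j : ℕ) (hj : j < l.length), (l.flatMap g).getD (j * c + r) false =
      (g (l[j])).getD r false := by
  induction l with
  | nil => exact fun j hj => absurd hj (by simp)
  | cons a l ih =>
    intro j hj
    rw [List.flatMap_cons]
    cases j with
    | zero =>
      rw [List.getD_append _ _ _ _ (by rw [hg]; omega)]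
      simp
    | succ j =>
      rw [List.getD_append_right _ _ _ _ (by rw [hg, Nat.succ_mul]; omega), hg,
        show (j + 1) * c + r - c = j * c + r by rw [Nat.succ_mul]; omega]
      exact ih j (by simpa using hj)

theorem mul_add_lt {a c j r : ℕ} (hj : j < a) (hr : r < c) : j * c + r < a * c :=
  calc j * c + r < j * c + c := Nat.add_lt_add_left hr _
    _ = (j + 1) * c := (Nat.succ_mul j c).symm
    _ ≤ a * c := Nat.mul_le_mul_right c hj

theorem exists_eq_mul_add {a c x : ℕ} (h : x < a * c) :
    ∃ (j : Fin a) (r : ℕ), r < c ∧ x = j * c + r := by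
  have hc : 0 < c := Nat.pos_of_mul_pos_left (Nat.zero_lt_of_lt h)
  exact ⟨⟨x / c, (Nat.div_lt_iff_lt_mul hc).2 h⟩, x % c, Nat.mod_lt _ hc,
    (Nat.div_add_mod' x c).symm⟩

namespace FSM

/-- The numbers of states, inputs and outputs in unary followed by a word. -/
def withHeader (n m k : ℕ) (T : List Bool) : List Bool :=
  List.replicate n true ++ false :: (List.replicate m true ++
    false :: (List.replicate k true ++ false :: T))

theorem length_withHeader (n m k : ℕ) (T : List Bool) :
    (withHeader n m k T).length = n + m + k + 3 + T.length := by
  simp only [withHeader, List.length_append, List.length_replicate, List.length_cons]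
  ring

theorem withHeader_injective {n m k n' m' k' : ℕ} {T T' : List Bool}
    (h : withHeader n m k T = withHeader n' m' k' T') : n = n' ∧ m = m' ∧ k = k' ∧ T = T' := by
  simpa only [withHeader, replicate_append_inj] using h

theorem eq_withHeader_iff {n m k : ℕ} {w T : List Bool} :
    w = withHeader n m k T ↔ w.length = n + m + k + 3 + T.length ∧
      ((∀ x < n, w.getD x false = true) ∧ w.getD n false = false) ∧
      ((∀ x < m, w.getD (n + 1 + x) false = true) ∧ w.getD (n + 1 + m) false = false) ∧
      ((∀ x < k, w.getD (n + 1 + (m + 1) + x) false = true) ∧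
        w.getD (n + 1 + (m + 1) + k) false = false) ∧
      w.drop (n + 1 + (m + 1) + (k + 1)) = T := by
  have hdrop (h : w.drop (n + 1 + (m + 1) + (k + 1)) = T) :
      n < w.length ∧ m < w.length - (n + 1) ∧ k < w.length - (n + 1 + (m + 1)) ↔
        w.length = n + m + k + 3 + T.length := by
    rw [← h, List.length_drop]
    lia
  simp only [withHeader, eq_replicate_append_iff, List.length_drop, getD_drop, List.drop_drop]
  tauto

theorem getD_withHeader_add (n m k : ℕ) (T : List Bool) (j : ℕ) :
    (withHeader n m k T).getD (n + m + k + 3 + j) false = T.getD j false := by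
  obtain ⟨-, -, -, -, hdrop⟩ := (eq_withHeader_iff (w := withHeader n m k T)).1 rfl
  rw [← getD_drop, show n + m + k + 3 = n + 1 + (m + 1) + (k + 1) by ring, hdrop]

theorem exists_eq_withHeader_iff {n m k c : ℕ} {w : List Bool} :
    (∃ T, T.length = c ∧ w = withHeader n m k T) ↔ w.length = n + m + k + 3 + c ∧
      ((∀ x < n, w.getD x false = true) ∧ w.getD n false = false) ∧
      ((∀ x < m, w.getD (n + 1 + x) false = true) ∧ w.getD (n + 1 + m) false = false) ∧
      (∀ x < k, w.getD (n + 1 + (m + 1) + x) false = true) ∧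
        w.getD (n + 1 + (m + 1) + k) false = false := by
  simp only [eq_withHeader_iff]
  constructor
  · rintro ⟨T, rfl, hlen, hn, hm, hk, -⟩
    exact ⟨hlen, hn, hm, hk⟩
  · rintro ⟨hlen, hn, hm, hk⟩
    have hT : (w.drop (n + 1 + (m + 1) + (k + 1))).length = c := by
      rw [List.length_drop]
      lia
    exact ⟨_, hT, hT ▸ hlen, hn, hm, hk, rfl⟩

variable {n m k : ℕ}

open Classical in
/-- The characteristic table of the transition relation. -/
noncomputable def table (M : FSM (Fin n) (Fin m) (Fin k)) : List Bool :=
  (List.finRange n).flatMap fun s =>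
    (List.finRange m).flatMap fun i =>
      (List.finRange k).flatMap fun o =>
        (List.finRange n).map fun s' => decide (M.trans s i o s')

theorem code_eq (M : FSM (Fin n) (Fin m) (Fin k)) : M.code = withHeader n m k (table M) := by
  simp [FSM.code, withHeader, table]

theorem length_table (M : FSM (Fin n) (Fin m) (Fin k)) :
    (table M).length = n * (m * (k * n)) := by
  simp [table]

/-- The machine with a given characteristic table. -/
def ofTable (n m k : ℕ) (T : List Bool) : FSM (Fin n) (Fin m) (Fin k) where
  trans s i o s' := T.getD (s * (m * (k * n)) + (i * (k * n) + (o * n + s'))) false = true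

theorem getD_table (M : FSM (Fin n) (Fin m) (Fin k)) (s : Fin n) (i : Fin m) (o : Fin k)
    (s' : Fin n) :
    (table M).getD (s * (m * (k * n)) + (i * (k * n) + (o * n + s'))) false = true ↔
      M.trans s i o s' := by
  have h₁ : (s' : ℕ) < n := s'.2
  have h₂ : (o : ℕ) * n + s' < k * n := mul_add_lt o.2 h₁
  have h₃ : (i : ℕ) * (k * n) + (o * n + s') < m * (k * n) := mul_add_lt i.2 h₂
  unfold table
  rw [getD_flatMap (c := m * (k * n)) (by simp) h₃ _ _ (by simp),
    getD_flatMap (c := k * n) (by simp) h₂ _ _ (by simp),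
    getD_flatMap (c := n) (by simp) h₁ _ _ (by simp)]
  simp [List.getD_eq_getElem?_getD]

theorem ofTable_table (M : FSM (Fin n) (Fin m) (Fin k)) : ofTable n m k (table M) = M := by
  refine congrArg FSM.mk ?_
  ext s i o s'
  exact getD_table M s i o s'

theorem table_ofTable {T : List Bool} (hT : T.length = n * (m * (k * n))) :
    table (ofTable n m k T) = T := by
  refine List.ext_getElem (by rw [length_table, hT]) fun x h₁ h₂ => ?_
  rw [← List.getD_eq_getElem _ false h₁, ← List.getD_eq_getElem _ false h₂]
  rw [hT] at h₂
  obtain ⟨s, y, hy, rfl⟩ := exists_eq_mul_add h₂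
  obtain ⟨i, z, hz, rfl⟩ := exists_eq_mul_add hy
  obtain ⟨o, r, hr, rfl⟩ := exists_eq_mul_add hz
  exact Bool.eq_iff_iff.2 (getD_table _ s i o ⟨r, hr⟩)

theorem length_code (M : FSM (Fin n) (Fin m) (Fin k)) :
    M.code.length = n + m + k + 3 + n * (m * (k * n)) := by
  rw [code_eq, length_withHeader, length_table]

theorem code_mem_iff {n m k : ℕ} (M : FSM (Fin n) (Fin m) (Fin k)) (hm : 0 < m) (hk : 0 < k)
    (hcomp : M.Complete) (hobs : M.Observable) :
    M.code ∈ FSM.adaptiveHomingLanguage ↔ M.AdaptivelyHoming := by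
  constructor
  · rintro ⟨n', m', k', M', -, -, -, -, h, hcode⟩
    rw [code_eq, code_eq] at hcode
    obtain ⟨rfl, rfl, rfl, hT⟩ := withHeader_injective hcode
    rwa [← ofTable_table M, ← hT, ofTable_table]
  · exact fun h => ⟨n, m, k, M, hm, hk, hcomp, hobs, h, rfl⟩

theorem mem_adaptiveHomingLanguage_iff {w : List Bool} :
    w ∈ adaptiveHomingLanguage ↔ ∃ n m k T, (T.length = n * (m * (k * n)) ∧
      w = withHeader n m k T) ∧ (0 < n ∧ 0 < m ∧ 0 < k) ∧ (ofTable n m k T).Complete ∧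
      (ofTable n m k T).Observable ∧ ∀ s t, (ofTable n m k T).PairHoming s t := by
  constructor
  · rintro ⟨n, m, k, M, hm, hk, hcomp, hobs, hhom, rfl⟩
    have : Nonempty (Fin n) := hhom.nonempty
    have : Nonempty (Fin k) := ⟨⟨0, hk⟩⟩
    refine ⟨n, m, k, table M, ⟨length_table M, code_eq M⟩,
      ⟨Fin.pos_iff_nonempty.2 ‹_›, hm, hk⟩, ?_⟩
    rw [ofTable_table]
    exact ⟨hcomp, hobs, (adaptivelyHoming_iff hobs).1 hhom⟩
  · rintro ⟨n, m, k, T, ⟨hT, rfl⟩, ⟨hn, hm, hk⟩, hcomp, hobs, hhom⟩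
    have : Nonempty (Fin n) := ⟨⟨0, hn⟩⟩
    have : Nonempty (Fin k) := ⟨⟨0, hk⟩⟩
    exact ⟨n, m, k, _, hm, hk, hcomp, hobs, (adaptivelyHoming_iff hobs).2 hhom, by
      rw [code_eq, table_ofTable hT]⟩

end FSM

namespace WordTerm

variable {ν : Type}

/-- The negation of a formula. -/
def not (t : WordTerm ν) : WordTerm ν := sub one t

/-- The formula `t < u`. -/
def lt (t u : WordTerm ν) : WordTerm ν := sub u t

/-- The conjunction of two formulas. -/
def and (t u : WordTerm ν) : WordTerm ν := mul t u

/-- The disjunction of two formulas. -/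
def or (t u : WordTerm ν) : WordTerm ν := add t u

/-- The implication between two formulas. -/
def imp (t u : WordTerm ν) : WordTerm ν := or (not t) u

/-- The formula `t = u`. -/
def eq (t u : WordTerm ν) : WordTerm ν := and (not (lt t u)) (not (lt u t))

/-- The bounded quantifier `∃ x < t, u`. -/
def ex (x : ν) (t u : WordTerm ν) : WordTerm ν := sum x t u

/-- The bounded quantifier `∀ x < t, u`. -/
def all (x : ν) (t u : WordTerm ν) : WordTerm ν := not (ex x t (not u))

variable [DecidableEq ν] {t u : WordTerm ν} {x : ν} {M : WordModel ν}

theorem holds_not : (not t).Holds M ↔ ¬ t.Holds M := by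
  simp only [Holds, not, eval]
  lia

theorem holds_lt : (lt t u).Holds M ↔ t.eval M < u.eval M :=
  Nat.sub_pos_iff_lt

theorem holds_and : (and t u).Holds M ↔ t.Holds M ∧ u.Holds M :=
  CanonicallyOrderedAdd.mul_pos

theorem holds_or : (or t u).Holds M ↔ t.Holds M ∨ u.Holds M :=
  add_pos_iff

theorem holds_imp : (imp t u).Holds M ↔ (t.Holds M → u.Holds M) := by
  rw [imp, holds_or, holds_not, imp_iff_not_or]

theorem holds_eq : (eq t u).Holds M ↔ t.eval M = u.eval M := by
  rw [eq, holds_and, holds_not, holds_not, holds_lt, holds_lt]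
  lia

theorem holds_ex : (ex x t u).Holds M ↔ ∃ j < t.eval M, u.Holds (M.assign x j) := by
  simp [Holds, ex, eval, Finset.sum_pos_iff]

theorem holds_all : (all x t u).Holds M ↔ ∀ j < t.eval M, u.Holds (M.assign x j) := by
  simp [all, holds_not, holds_ex]

theorem holds_input : (input t).Holds M ↔ M.inp.getD (t.eval M) false = true := by
  rw [Holds, eval]
  cases M.inp.getD (t.eval M) false <;> simp

theorem holds_table : (table t).Holds M ↔ M.tab.getD (t.eval M) false = true := by
  rw [Holds, eval]
  cases M.tab.getD (t.eval M) false <;> simp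

end WordTerm

/-- The variables of the formulas about codes of machines: the numbers of states, inputs and
outputs, the states, inputs and outputs themselves, an index of a bit of the code and an index of
a bit of the table. -/
inductive CodeVar : Type
  | n | m | k
  | s | t | u | v
  | i | o
  | x | p
  deriving DecidableEq

instance : Fintype CodeVar :=
  ⟨{.n, .m, .k, .s, .t, .u, .v, .i, .o, .x, .p}, fun y => by cases y <;> decide⟩

namespace CodeVar

open WordTerm

/-- The bits of the input word from position `a` on start with `c` ones and a zero. -/
def unary (a c : WordTerm CodeVar) : WordTerm CodeVar :=
  and (all x c (input (add a (var x)))) (not (input (add a c)))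

/-- The input word is the code of a machine with the sizes `n`, `m` and `k`. -/
def isCode : WordTerm CodeVar :=
  and (eq len (add (add (add (add (var n) (var m)) (var k)) (add one (add one one)))
      (mul (var n) (mul (var m) (mul (var k) (var n))))))
    (and (unary (sub one one) (var n)) (and (unary (add (var n) one) (var m))
      (unary (add (add (var n) one) (add (var m) one)) (var k))))

/-- The transition from `a` to `b` with input `y` and output `z`. -/
def trans (a y z b : CodeVar) : WordTerm CodeVar :=
  input (add (add (add (add (var n) (var m)) (var k)) (add one (add one one)))
    (add (mul (var a) (mul (var m) (mul (var k) (var n))))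
      (add (mul (var y) (mul (var k) (var n))) (add (mul (var z) (var n)) (var b)))))

/-- The index in the table of the pair `(a, b)`. -/
def pair (a b : CodeVar) : WordTerm CodeVar :=
  add (mul (var a) len) (var b)

/-- The input word is the code of a machine, of which `φ` holds once its sizes are assigned to
`n`, `m` and `k`. -/
def exCode (φ : WordTerm CodeVar) : WordTerm CodeVar :=
  ex n len (ex m len (ex k len (and isCode φ)))

/-- The bit `p` of the table obtained by one application of `FSM.pairStep`. -/
def homingStep : WordTerm CodeVar :=
  exCode (ex s (var n) (ex t (var n) (and (eq (var p) (pair s t)) (or (eq (var s) (var t))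
    (ex i (var m) (all o (var k) (all u (var n) (all v (var n)
      (imp (trans s i o u) (imp (trans t i o v) (table (pair u v))))))))))))

/-- The input word is the code of a complete observable machine, and the table contains all pairs
of its states. -/
def homing : WordTerm CodeVar :=
  exCode (and (and (var n) (and (var m) (var k)))
    (and (all s (var n) (all i (var m) (ex o (var k) (ex u (var n) (trans s i o u)))))
    (and (all s (var n) (all i (var m) (all o (var k) (all u (var n) (all v (var n)
      (imp (trans s i o u) (imp (trans s i o v) (eq (var u) (var v)))))))))
    (all s (var n) (all t (var n) (table (pair s t)))))))

theorem holds_isCode {M : WordModel CodeVar} : isCode.Holds M ↔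
    ∃ T, T.length = M.env n * (M.env m * (M.env k * M.env n)) ∧
      M.inp = FSM.withHeader (M.env n) (M.env m) (M.env k) T := by
  rw [FSM.exists_eq_withHeader_iff]
  simp [isCode, unary, holds_and, holds_not, holds_all, holds_input, holds_eq, eval,
    WordModel.assign]

theorem holds_exCode {φ : WordTerm CodeVar} {M : WordModel CodeVar} : (exCode φ).Holds M ↔
    ∃ n m k T, (T.length = n * (m * (k * n)) ∧ M.inp = FSM.withHeader n m k T) ∧
      φ.Holds (((M.assign .n n).assign .m m).assign .k k) := by
  have hlt (n m k : ℕ) : (∃ T, T.length = n * (m * (k * n)) ∧ M.inp = FSM.withHeader n m k T) →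
      n < M.inp.length ∧ m < M.inp.length ∧ k < M.inp.length := by
    rintro ⟨T, -, h⟩
    rw [h, FSM.length_withHeader]
    lia
  simp only [exCode, holds_ex, holds_and, holds_isCode]
  constructor
  · rintro ⟨n, -, m, -, k, -, ⟨T, h⟩, hφ⟩
    exact ⟨n, m, k, T, h, hφ⟩
  · rintro ⟨n, m, k, T, h, hφ⟩
    obtain ⟨hn, hm, hk⟩ := hlt n m k ⟨T, h⟩
    exact ⟨n, hn, m, hm, k, hk, ⟨T, h⟩, hφ⟩

variable {n m k : ℕ} {T w : List Bool}

theorem holds_exCode_withHeader {φ : WordTerm CodeVar} {M : WordModel CodeVar}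
    (hT : T.length = n * (m * (k * n))) (hM : M.inp = FSM.withHeader n m k T) :
    (exCode φ).Holds M ↔ φ.Holds (((M.assign .n n).assign .m m).assign .k k) := by
  rw [holds_exCode]
  constructor
  · rintro ⟨n', m', k', T', ⟨-, h⟩, hφ⟩
    obtain ⟨rfl, rfl, rfl, -⟩ := FSM.withHeader_injective (hM.symm.trans h)
    exact hφ
  · exact fun h => ⟨n, m, k, T, ⟨hT, hM⟩, h⟩

theorem holds_var {a : CodeVar} {M : WordModel CodeVar} : (var a).Holds M ↔ 0 < M.env a :=
  Iff.rfl

theorem holds_homing {H : List Bool} {e : CodeVar → ℕ} : homing.Holds ⟨w, H, e⟩ ↔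
    ∃ n m k T, (T.length = n * (m * (k * n)) ∧ w = FSM.withHeader n m k T) ∧
      (0 < n ∧ 0 < m ∧ 0 < k) ∧ (FSM.ofTable n m k T).Complete ∧
      (FSM.ofTable n m k T).Observable ∧
      ∀ s t : Fin n, H.getD (s * w.length + t) false = true := by
  rw [homing, holds_exCode]
  refine exists_congr fun n => exists_congr fun m => exists_congr fun k => exists_congr fun T =>
    and_congr_right ?_
  rintro ⟨-, rfl⟩
  simp [holds_and, holds_all, holds_ex, holds_imp, holds_eq, holds_var, trans, pair, holds_table,
    holds_input, eval, WordModel.assign, FSM.getD_withHeader_add, FSM.Complete, FSM.Observable,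
    FSM.DefinedAt, FSM.ofTable, Fin.forall_iff, Fin.exists_iff, -List.getD_eq_getElem?_getD]

theorem exists_pair_iff {P : ℕ → ℕ → Prop} {L : ℕ} (hL : n ≤ L) (s t : Fin n) :
    (∃ a < n, ∃ b < n, s * L + t = a * L + b ∧ P a b) ↔ P s t := by
  constructor
  · rintro ⟨a, -, b, hb, h, hP⟩
    obtain rfl : t.1 = b := by
      simpa only [Nat.mul_add_mod_of_lt, t.2.trans_le hL, hb.trans_le hL] using congrArg (· % L) h
    rwa [Nat.eq_of_mul_eq_mul_right (hb.trans_le hL).pos (Nat.add_right_cancel h)]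
  · exact fun h => ⟨s, s.2, t, t.2, rfl, h⟩

theorem holds_homingStep {H : List Bool} {e : CodeVar → ℕ} (hT : T.length = n * (m * (k * n)))
    (hw : w = FSM.withHeader n m k T) (s t : Fin n) :
    homingStep.Holds (WordModel.assign ⟨w, H, e⟩ .p (s * w.length + t)) ↔
      (s, t) ∈ (FSM.ofTable n m k T).pairStep {q | H.getD (q.1 * w.length + q.2) false = true} := by
  have hn : n ≤ w.length := by
    rw [hw, FSM.length_withHeader]
    lia
  rw [homingStep, holds_exCode_withHeader hT hw]
  subst w
  simp [holds_and, holds_or, holds_all, holds_ex, holds_imp, holds_eq, trans, pair, holds_table,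
    holds_input, eval, WordModel.assign, FSM.getD_withHeader_add, exists_pair_iff hn,
    FSM.ofTable, FSM.pairStep, Fin.forall_iff, Fin.exists_iff, Fin.ext_iff,
    -List.getD_eq_getElem?_getD]

theorem setOf_iterate_nextTable (hT : T.length = n * (m * (k * n)))
    (hw : w = FSM.withHeader n m k T) (j : ℕ) :
    {q : Fin n × Fin n |
      ((nextTable 2 p homingStep w)^[j] []).getD (q.1 * w.length + q.2) false = true} =
      (FSM.ofTable n m k T).pairStep^[j] ∅ := by
  induction j with
  | zero => simp
  | succ j ih =>
    have hn : n ≤ w.length := by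
      rw [hw, FSM.length_withHeader]
      lia
    ext ⟨s, t⟩
    rw [Function.iterate_succ_apply', Function.iterate_succ_apply', ← ih,
      ← holds_homingStep hT hw]
    exact getD_nextTable (sq w.length ▸
      mul_add_lt (s.2.trans_le hn) (t.2.trans_le hn))

theorem holds_homing_iteratedTable :
    homing.Holds ⟨w, iteratedTable 2 p homingStep w, fun _ => 0⟩ ↔
      w ∈ FSM.adaptiveHomingLanguage := by
  rw [holds_homing, FSM.mem_adaptiveHomingLanguage_iff]
  refine exists_congr fun n => exists_congr fun m => exists_congr fun k => exists_congr fun T =>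
    and_congr_right ?_
  rintro ⟨hT, hw⟩
  have hcard : Nat.card (Fin n × Fin n) ≤ w.length ^ 2 := by
    rw [Nat.card_prod, Nat.card_fin, ← sq, hw, FSM.length_withHeader]
    exact Nat.pow_le_pow_left (by lia) 2
  simp only [FSM.pairHoming_iff_mem_iterate _ hcard, ← setOf_iterate_nextTable hT hw]
  rfl

end CodeVar

theorem nonempty_polyTimeDecider_adaptiveHomingLanguage :
    Nonempty (PolyTimeDecider FSM.adaptiveHomingLanguage) := by
  have h := WordTerm.nonempty_polyTimeDecider 2 CodeVar.p CodeVar.homingStep CodeVar.homing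
  simpa only [CodeVar.holds_homing_iteratedTable, Set.ofPred_mem_eq] using h

theorem PolyTimeDecider.answersInTime_code (A : PolyTimeDecider FSM.adaptiveHomingLanguage)
    {n m k : ℕ} (M : FSM (Fin n) (Fin m) (Fin k)) (hm : 0 < m) (hk : 0 < k) (hcomp : M.Complete)
    (hobs : M.Observable) :
    AnswersInTime A.toTM2ComputableAux M.code M.AdaptivelyHoming (A.time.eval M.code.length) := by
  have h := A.outputsFun M.code
  beta_reduce at h
  rw [decide_eq_decide.2 (FSM.code_mem_iff M hm hk hcomp hobs)] at h
  exact ⟨h⟩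

theorem AnswersInTime.mono {A : Turing.TM2ComputableAux Bool Bool} {w : List Bool} {p : Prop}
    {t t' : ℕ} (h : AnswersInTime A w p t) (ht : t ≤ t') : AnswersInTime A w p t' :=
  h.map fun h => { h with steps_le_m := h.steps_le_m.trans ht }

theorem polynomial_eval_monotone (p : Polynomial ℕ) : Monotone fun n => p.eval n := by
  intro a b hab
  simp only [Polynomial.eval_eq_sum]
  exact Finset.sum_le_sum fun i _ => Nat.mul_le_mul_left _ (Nat.pow_le_pow_left hab i)

theorem FSM.length_code_le {n m k : ℕ} (M : FSM (Fin n) (Fin m) (Fin k)) {q : Polynomial ℕ}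
    (hm : m ≤ q.eval n) (hk : k ≤ q.eval n) :
    M.code.length ≤
      (.X + q + q + 3 + .X * (q * (q * .X)) : Polynomial ℕ).eval n := by
  simp only [length_code, Polynomial.eval_add, Polynomial.eval_mul, Polynomial.eval_X,
    Polynomial.eval_ofNat]
  gcongr

/-- Existence of a homing test case for a complete observable machine is decidable in polynomial
time: the corresponding language is in P, and the decider runs in time polynomial in the number
of states alone on machines whose numbers of inputs and outputs are polynomially bounded in the
number of states. -/
theorem proposition5 :
    ∃ A : PolyTimeDecider FSM.adaptiveHomingLanguage,
      ∀ q : Polynomial ℕ, ∃ r : Polynomial ℕ,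
        ∀ (n m k : ℕ) (M : FSM (Fin n) (Fin m) (Fin k)), 0 < m → 0 < k →
          M.Complete → M.Observable → m ≤ q.eval n → k ≤ q.eval n →
            AnswersInTime A.toTM2ComputableAux M.code M.AdaptivelyHoming (r.eval n) := by
  obtain ⟨A⟩ := nonempty_polyTimeDecider_adaptiveHomingLanguage
  refine ⟨A, fun q => ⟨A.time.comp (.X + q + q + 3 + .X * (q * (q * .X))),
    fun n m k M hm hk hcomp hobs hmq hkq => ?_⟩⟩
  rw [Polynomial.eval_comp]
  exact (A.answersInTime_code M hm hk hcomp hobs).mono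
    (polynomial_eval_monotone _ (M.length_code_le hmq hkq))
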